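/- **Setting.** Let $\mathsf X$ and $\mathsf U$ be finite state and action spaces and let $K(y|x,u)$ be a transition kernel. A Markov policy is a stochastic matrix $P=[P(u|x)]$; write $K(y|x,P)=\sum_u K(y|x,u)P(u|x)$. Assume uniform mixing: for some $\tau>0$, $$\|\mu_1K(\cdot|P)-\mu_2K(\cdot|P)\|_1\le e^{-1/\tau}\|\mu_1-\mu_2\|_1$$ for all Markov policies $P$ and all distributions $\mu_1,\mu_2$ on $\mathsf X$. In particular each $P$ has a unique invariant distribution $\pi_P$. Let $$\mathcal G=\Big\{\nu\in\mathcal P(\mathsf X\times\mathsf U):\ \sum_{x,u}K(y|x,u)\nu(x,u)=\sum_u\nu(y,u)\ \ \forall y\in\mathsf X\Big\}$$ be the state-action polytope, $\mathrm{int}(\mathcal G)$ its interior relative to its affine hull, and $V\subseteq\mathbb R^{\mathsf X\times\mathsf U}$ the direction space of that affine hull. A policy $P$ is said to be induced by $\nu\in\mathcal G$, written $P=P_\nu$, if $P(u|x)=\nu(x,u)/\sum_v\nu(x,v)$ whenever the denominator is nonzero (it is arbitrary at the other states). **Regularizer.** Let $F:\mathrm{int}(\mathcal G)\to\mathbb R$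 be a self-concordant barrier: $F$ is convex and $C^3$, $F(\nu_i)\to+\infty$ whenever points $\nu_i\in\mathrm{int}(\mathcal G)$ converge to a point of $\mathcal G\setminus\mathrm{int}(\mathcal G)$, and $\nabla^3F(\nu)[h,h,h]\le2(\nabla^2F(\nu)[h,h])^{3/2}$ for all $\nu\in\mathrm{int}(\mathcal G)$ and $h\in V$. Here derivatives of $F$ are taken along $V$, and $\nabla F(\nu)\in V$. Let $F^*(h)=\sup_{\nu\in\mathrm{int}(\mathcal G)}\{\langle h,\nu\rangle-F(\nu)\}$ for $h\in\mathbb R^{\mathsf X\times\mathsf U}$. Assume that $F$ is strictly convex on $\mathrm{int}(\mathcal G)$ and $F^*$ is strictly convex on $V$, that $\nabla F:\mathrm{int}(\mathcal G)\to V$ is a bijection whose inverse is $h\mapsto\nabla F^*(h)$, and that $\min_{\mathrm{int}(\mathcal G)}F=0$. Put $D_F(\mu,\nu)=F(\mu)-F(\nu)-\langle\nabla F(\nu),\mu-\nu\rangle$ and $\|f\|^*_h=\sqrt{\nabla^2F^*(h)[f,f]}$. **Algorithm.** Let $\mathcal F$ be a class of functions $\mathsf X\times\mathsf U\to\mathbb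 R$, $C_{\mathcal F}=\sup_{f\in\mathcal F}\|f\|_\infty\in[0,\infty]$, $T\ge1$, $f_1,\dots,f_T\in\mathcal F$ and $\rho>0$. Let $\nu_1=\arg\min_{\mathrm{int}(\mathcal G)}F$, $\nu_{t+1}=\nabla F^*(\nabla F(\nu_t)-\rho f_t)$ for $1\le t<T$, and let $P_t=P_{\nu_t}$ be a Markov policy induced by $\nu_t$. Starting from $X_1=x$, where $x\in\mathsf X$ is arbitrary, let $U_t\sim P_t(\cdot|X_t)$ and $X_{t+1}\sim K(\cdot|X_t,U_t)$. **Theorem.** Suppose that $\rho\|f_t\|^*_{\nabla F(\nu_t)}\le\frac12$ and $\|f_t\|^*_{\nabla F(\nu_t)}\le1$ for $t=1,\dots,T$. Let $\mathcal G'\subseteq\mathrm{int}(\mathcal G)$ be nonempty, let $\mathcal M(\mathcal G')$ be the set of Markov policies induced by elements of $\mathcal G'$, and let $D_F(\mathcal G')=\sup_{\nu\in\mathcal G'}D_F(\nu,\nu_1)\in[0,\infty]$. Then $$\mathbb E_x\Big[\sum_{t=1}^Tf_t(X_t,U_t)\Big]-\inf_{P\in\mathcal M(\mathcal G')}\ \sum_{t=1}^T\sum_{x',u}\pi_P(x')P(u|x')f_t(x',u)\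 \le\ \frac{D_F(\mathcal G')}{\rho}+2\rho T+C_{\mathcal F}(\tau+1)^2T\Delta_T+(2\tau+2)C_{\mathcal F},$$ where $\Delta_T=\max_{2\le t\le T}\max_{x'\in\mathsf X}\|P_{t-1}(\cdot|x')-P_t(\cdot|x')\|_1$ (and $\Delta_1=0$), and $0\cdot\infty=0$ on the right-hand side. -/

import Mathlib

noncomputable section

namespace OnlineMDP

/-! ## Self-concordant barriers on a compact convex set, relative to its affine hull

`K` is a convex set in a finite-dimensional Euclidean space `E`. The interior of `K` is taken in the
affine hull of `K` (`intrinsicInterior ℝ K`), and derivatives of a function on it are taken along the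
direction space of that affine hull (`vectorSpan ℝ K`). If `K` has nonempty interior in `E`, these are
the usual interior, all of `E`, and the usual derivatives. -/

section Barrier

variable {E : Type*} [NormedAddCommGroup E] [InnerProductSpace ℝ E] [FiniteDimensional ℝ E]

/-- The function `h ↦ F (v + h)` on the direction space of the affine hull of `K`. Its derivatives
at `0` are the derivatives of `F` at `v`. -/
def localRep (K : Set E) (F : E → ℝ) (v : E) : vectorSpan ℝ K → ℝ := fun h => F (v + (h : E))

/-- The gradient `∇F(v)`, an element of the direction space of the affine hull of `K`. -/
def grad (K : Set E) (F : E → ℝ) (v : E) : E :=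
  ((gradient (localRep K F v) 0 : vectorSpan ℝ K) : E)

/-- `∇²F(v)[h,h]`. -/
def hess (K : Set E) (F : E → ℝ) (v : E) (h : vectorSpan ℝ K) : ℝ :=
  iteratedFDeriv ℝ 2 (localRep K F v) 0 (fun _ => h)

/-- `∇³F(v)[h,h,h]`. -/
def third (K : Set E) (F : E → ℝ) (v : E) (h : vectorSpan ℝ K) : ℝ :=
  iteratedFDeriv ℝ 3 (localRep K F v) 0 (fun _ => h)

/-- `F` is a self-concordant barrier on the convex set `K`. Only the values of `F` on the relative
interior of `K` matter. -/
structure IsSelfConcordantBarrier (K : Set E) (F : E → ℝ) : Prop where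
  barrier : ∀ (x : ℕ → E) (y : E), (∀ i, x i ∈ intrinsicInterior ℝ K) →
    y ∈ K \ intrinsicInterior ℝ K → Filter.Tendsto x Filter.atTop (nhds y) →
    Filter.Tendsto (fun i => F (x i)) Filter.atTop Filter.atTop
  convex : ConvexOn ℝ (intrinsicInterior ℝ K) F
  smooth : ∀ v ∈ intrinsicInterior ℝ K, ContDiffAt ℝ 3 (localRep K F v) 0
  selfConcordant : ∀ v ∈ intrinsicInterior ℝ K, ∀ h : vectorSpan ℝ K,
    third K F v h ≤ 2 * (hess K F v h) ^ (3 / 2 : ℝ)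

/-- The Bregman divergence `D_F(v,w) = F(v) - F(w) - ⟨∇F(w), v - w⟩`. -/
def bregman (K : Set E) (F : E → ℝ) (v w : E) : ℝ :=
  F v - F w - inner ℝ (grad K F w) (v - w)

/-- The Legendre–Fenchel dual `F*(h) = sup {⟨h,v⟩ - F(v) : v ∈ relint K}`, a function on `E`. -/
def dual (K : Set E) (F : E → ℝ) (h : E) : ℝ :=
  sSup ((fun v => inner ℝ h v - F v) '' intrinsicInterior ℝ K)

/-- The dual local norm `‖f‖*_h = √(∇²F*(h)[f,f])`. -/
def dualLocalNorm (K : Set E) (F : E → ℝ) (h f : E) : ℝ :=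
  Real.sqrt (iteratedFDeriv ℝ 2 (dual K F) h (fun _ => f))

/-- The properties required of the regularizer: `F` is a self-concordant barrier on `K`; `F` and its
dual are strictly convex; `∇F` is a bijection from the relative interior of `K` onto the direction
space of its affine hull, with inverse `∇F*`; the minimum of `F` is `0`. -/
structure IsRegularizer (K : Set E) (F : E → ℝ) : Prop where
  selfConcordantBarrier : IsSelfConcordantBarrier K F
  strictConvex : StrictConvexOn ℝ (intrinsicInterior ℝ K) F
  strictConvex_dual : StrictConvexOn ℝ (vectorSpan ℝ K : Set E) (dual K F)
  bijOn_grad : Set.BijOn (grad K F) (intrinsicInterior ℝ K) (vectorSpan ℝ K : Set E)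
  invOn_grad : Set.InvOn (gradient (dual K F)) (grad K F)
    (intrinsicInterior ℝ K) (vectorSpan ℝ K : Set E)
  min_eq_zero : IsLeast (F '' intrinsicInterior ℝ K) 0

end Barrier

/-! ## Markov decision processes with finite state space `X` and finite action space `U` -/

section MDP

variable {X U : Type*} [Fintype X] [Fintype U]

/-- `μ` is a probability distribution on the finite set `S`. -/
def IsDist {S : Type*} [Fintype S] (μ : S → ℝ) : Prop :=
  (∀ s, 0 ≤ μ s) ∧ ∑ s, μ s = 1

/-- `K x u y = K(y|x,u)` is a transition kernel. -/
def IsTransitionKernel (K : X → U → X → ℝ) : Prop := ∀ x u, IsDist (K x u)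

/-- `P x u = P(u|x)` is a Markov policy (randomized state feedback law). -/
def IsPolicy (P : X → U → ℝ) : Prop := ∀ x, IsDist (P x)

/-- The state transition matrix `K(y|x,P)` induced by the policy `P`. -/
def stateKernel (K : X → U → X → ℝ) (P : X → U → ℝ) (x y : X) : ℝ :=
  ∑ u, K x u y * P x u

/-- The distribution `μ K(·|P)`. -/
def push (K : X → U → X → ℝ) (P : X → U → ℝ) (μ : X → ℝ) (y : X) : ℝ :=
  ∑ x, μ x * stateKernel K P x y

/-- The total variation distance `‖μ₁ - μ₂‖₁`. -/
def tv {S : Type*} [Fintype S] (μ₁ μ₂ : S → ℝ) : ℝ := ∑ s, |μ₁ s - μ₂ s|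

/-- The uniform mixing condition with constant `τ`. -/
def UniformMixing (K : X → U → X → ℝ) (τ : ℝ) : Prop :=
  ∀ P : X → U → ℝ, IsPolicy P → ∀ μ₁ μ₂ : X → ℝ, IsDist μ₁ → IsDist μ₂ →
    tv (push K P μ₁) (push K P μ₂) ≤ Real.exp (-1 / τ) * tv μ₁ μ₂

/-- `π` is an invariant distribution of the state chain induced by `P`. -/
def IsInvariant (K : X → U → X → ℝ) (P : X → U → ℝ) (π : X → ℝ) : Prop :=
  IsDist π ∧ push K P π = π

/-- The state-action polytope. -/
def polytope (K : X → U → X → ℝ) : Set (EuclideanSpace ℝ (X × U)) :=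
  {ν | IsDist (fun p : X × U => ν p) ∧
    ∀ y, ∑ x, ∑ u, K x u y * ν (x, u) = ∑ u, ν (y, u)}

/-- `P` has the form `P_ν(u|x) = ν(x,u) / ∑ v, ν(x,v)` at every state where the denominator is
nonzero. At the remaining states `P` is arbitrary. -/
def Induces (ν : EuclideanSpace ℝ (X × U)) (P : X → U → ℝ) : Prop :=
  ∀ x, ∑ v, ν (x, v) ≠ 0 → ∀ u, P x u = ν (x, u) / ∑ v, ν (x, v)

/-- The set of the policies that have the form `P_ν` for some `ν ∈ G'`. -/
def policiesOf (G' : Set (EuclideanSpace ℝ (X × U))) : Set (X → U → ℝ) :=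
  {P | IsPolicy P ∧ ∃ ν ∈ G', Induces ν P}

/-- The probability of the trajectory `ω = ((x₁,u₁),…,(xₙ,uₙ))` when `X₁ = x`, `U_t ∼ P_t(·|X_t)` and
`X_{t+1} ∼ K(·|X_t,U_t)`. Entry `i : Fin n` of `ω` belongs to time `i + 1`. -/
def pathProb [DecidableEq X] (K : X → U → X → ℝ) (P : ℕ → X → U → ℝ) (x : X) :
    (n : ℕ) → (Fin n → X × U) → ℝ
  | 0, _ => 1
  | 1, ω => (if (ω 0).1 = x then 1 else 0) * P 1 (ω 0).1 (ω 0).2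
  | n + 2, ω =>
      pathProb K P x (n + 1) (fun i => ω i.castSucc)
        * K (ω (Fin.last n).castSucc).1 (ω (Fin.last n).castSucc).2 (ω (Fin.last (n + 1))).1
        * P (n + 2) (ω (Fin.last (n + 1))).1 (ω (Fin.last (n + 1))).2

/-- The expected total cost `𝔼_x [∑_{t=1}^T f_t(X_t,U_t)]` of the policies `P_1,…,P_T`. -/
def expectedCost [DecidableEq X] (K : X → U → X → ℝ) (P : ℕ → X → U → ℝ) (f : ℕ → X × U → ℝ)
    (x : X) (T : ℕ) : ℝ :=
  ∑ ω : Fin T → X × U, pathProb K P x T ω * ∑ i : Fin T, f (i + 1) (ω i)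

/-- The comparator `inf {𝔼[∑_{t=1}^T f_t(X,U)] : P ∈ M}`, where `(X,U) ∼ π_P ⊗ P` and `π_P` is the
invariant distribution of `P`. -/
def comparator (K : X → U → X → ℝ) (M : Set (X → U → ℝ)) (f : ℕ → X × U → ℝ) (T : ℕ) : ℝ :=
  sInf {c | ∃ P ∈ M, ∃ π, IsInvariant K P π ∧
    c = ∑ x, ∑ u, π x * P x u * ∑ t ∈ Finset.Icc 1 T, f t (x, u)}

/-- The steady-state regret of `P_1,…,P_T` with respect to the policies induced by `G'`. -/
def regret [DecidableEq X] (K : X → U → X → ℝ) (G' : Set (EuclideanSpace ℝ (X × U)))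
    (P : ℕ → X → U → ℝ) (f : ℕ → X × U → ℝ) (x : X) (T : ℕ) : ℝ :=
  expectedCost K P f x T - comparator K (policiesOf G') f T

/-- The mirror-descent algorithm on the state-action polytope, run for `T` steps against the costs
`f_1,…,f_T` with learning rate `ρ`: it generates `ν_1,…,ν_T` and the policies `P_1,…,P_T`. -/
structure IsMirrorDescentRun (K : X → U → X → ℝ) (F : EuclideanSpace ℝ (X × U) → ℝ) (ρ : ℝ) (T : ℕ)
    (f : ℕ → X × U → ℝ) (ν : ℕ → EuclideanSpace ℝ (X × U)) (P : ℕ → X → U → ℝ) : Prop where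
  start_mem : ν 1 ∈ intrinsicInterior ℝ (polytope K)
  start_min : IsMinOn F (intrinsicInterior ℝ (polytope K)) (ν 1)
  step : ∀ t, 1 ≤ t → t < T → ν (t + 1) =
    gradient (dual (polytope K) F) (grad (polytope K) F (ν t) - ρ • WithLp.toLp 2 (f t))
  policy : ∀ t ∈ Finset.Icc 1 T, IsPolicy (P t) ∧ Induces (ν t) (P t)

/-- The maximal one-step drift `max_{2 ≤ t ≤ T} max_x ‖P_{t-1}(·|x) - P_t(·|x)‖₁` of the policies
(`0` if `T = 1`). -/
def drift (P : ℕ → X → U → ℝ) (T : ℕ) : ℝ :=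
  ⨆ p : Set.Icc 2 T × X, tv (P ((p.1 : ℕ) - 1) p.2) (P (p.1 : ℕ) p.2)

/-- `C_𝓕 = sup {‖f‖_∞ : f ∈ 𝓕}`, possibly infinite. -/
def costBound (𝓕 : Set (X × U → ℝ)) : EReal := ⨆ f ∈ 𝓕, ((‖f‖ : ℝ) : EReal)

/-- `D_F(G') = sup {D_F(ν, ν₁) : ν ∈ G'}`, possibly infinite. -/
def bregmanSup (K : X → U → X → ℝ) (F : EuclideanSpace ℝ (X × U) → ℝ)
    (G' : Set (EuclideanSpace ℝ (X × U))) (ν₁ : EuclideanSpace ℝ (X × U)) : EReal :=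
  ⨆ ν ∈ G', ((bregman (polytope K) F ν ν₁ : ℝ) : EReal)

end MDP

end OnlineMDP

end

/-! For `ν` in the polytope the state marginal is invariant under every induced policy, and `⟨f,ν⟩`
is the steady-state cost of that policy. The regret therefore splits into the regret of mirror
descent for linear losses on the polytope and the gap between the actual and the steady-state costs
of `P_1,…,P_T`.

Mirror descent: if `w` is the successor of `v`, then `ρ⟨f,v-z⟩ = D(z,v) - D(z,w) + (ρ⟨f,v-w⟩ -
D(w,v))`. Let `r` be the local norm of `w-v` at `v` and `s = ρ‖f‖*`. Cauchy–Schwarz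
(`inner_le_dualLocalNorm_mul`) gives `ρ⟨f,v-w⟩ ≤ s r`, self-concordance (`sub_log_le_bregman`) gives
`D(w,v) ≥ r - log (1+r)`, and the difference is at most `2s²` when `s ≤ 1/2`. The divergences
telescope. Cauchy–Schwarz requires that `∇²F*` be inverse to `∇²F` on the direction space; this
follows from the inverse function theorem because `∇²F` is nondegenerate (`exists_hessian_equiv`).

Mixing: since `e^{-1/τ} ≤ τ/(τ+1)`, the invariant distribution is `(τ+1)`-Lipschitz in the policy.
The distance `a_n` from the state law to the current invariant distribution then obeys `(τ+1)
a_{n+1} ≤ τ a_n + (τ+1)²Δ_T`, and summation gives the last two terms of the bound. -/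

set_option linter.unusedSectionVars false

noncomputable section

namespace OnlineMDP

/-! ### Differential inequalities for self-concordant functions of one variable -/

section RealFunctions

/-- A nonnegative function with `q' ≤ 2 q^{3/2}` that vanishes at `0` vanishes identically. -/
lemma eq_zero_of_deriv_le_rpow {q q' : ℝ → ℝ} (hq : ∀ t ∈ Set.Icc (0 : ℝ) 1, HasDerivAt q (q' t) t)
    (hq0 : ∀ t ∈ Set.Icc (0 : ℝ) 1, 0 ≤ q t)
    (hle : ∀ t ∈ Set.Icc (0 : ℝ) 1, q' t ≤ 2 * (q t) ^ (3 / 2 : ℝ)) (h0 : q 0 = 0) :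
    ∀ t ∈ Set.Icc (0 : ℝ) 1, q t = 0 := by
  have hcont : ContinuousOn q (Set.Icc 0 1) := fun t ht => (hq t ht).continuousAt.continuousWithinAt
  obtain ⟨B, hB⟩ := isCompact_Icc.bddAbove_image hcont
  have hB' : ∀ t ∈ Set.Icc (0 : ℝ) 1, q t ≤ B := fun t ht => hB ⟨t, ht, rfl⟩
  -- Bounding the factor `q^{1/2}` on the compact interval makes the inequality linear, `q' ≤ C q`,
  -- so Grönwall's argument applies.
  set C := 2 * B ^ (1 / 2 : ℝ)
  have hle' : ∀ t ∈ Set.Icc (0 : ℝ) 1, q' t ≤ C * q t := by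
    intro t ht
    refine (hle t ht).trans ?_
    have h1 : (q t) ^ (3 / 2 : ℝ) = q t ^ (1 / 2 : ℝ) * q t := by
      conv_rhs => rw [← Real.rpow_one (q t), ← Real.rpow_mul (hq0 t ht)]
      rw [← Real.rpow_add_of_nonneg (hq0 t ht) (by norm_num) (by norm_num)]
      norm_num
    rw [h1]
    have h2 : q t ^ (1 / 2 : ℝ) ≤ B ^ (1 / 2 : ℝ) :=
      Real.rpow_le_rpow (hq0 t ht) (hB' t ht) (by norm_num)
    have := mul_le_mul_of_nonneg_right h2 (hq0 t ht)
    simp only [C]; linarith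
  have hd : ∀ t ∈ Set.Icc (0 : ℝ) 1, HasDerivAt (fun t => Real.exp (-(C * t)) * q t)
      (Real.exp (-(C * t)) * (q' t - C * q t)) t := by
    intro t ht
    have h1 : HasDerivAt (fun t => -(C * t)) (-C) t :=
      ((hasDerivAt_id t).const_mul C).neg.congr_deriv (by simp)
    refine (h1.exp.mul (hq t ht)).congr_deriv ?_
    ring
  have hanti : AntitoneOn (fun t => Real.exp (-(C * t)) * q t) (Set.Icc 0 1) := by
    refine antitoneOn_of_deriv_nonpos (convex_Icc 0 1)
      (fun t ht => (hd t ht).continuousAt.continuousWithinAt)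
      (fun t ht => (hd t (interior_subset ht)).differentiableAt.differentiableWithinAt) ?_
    intro t ht
    rw [(hd t (interior_subset ht)).deriv]
    exact mul_nonpos_of_nonneg_of_nonpos (Real.exp_pos _).le
      (by linarith [hle' t (interior_subset ht)])
  intro t ht
  have := hanti (Set.left_mem_Icc.2 zero_le_one) ht ht.1
  simp only [h0, mul_zero] at this
  exact le_antisymm (nonpos_of_mul_nonpos_right this (Real.exp_pos _)) (hq0 t ht)

/-- A function whose derivative is nonnegative on `[0,1]` is at least its value at `0`. -/
lemma le_of_hasDerivAt_nonneg {g g' : ℝ → ℝ} (hg : ∀ t ∈ Set.Icc (0 : ℝ) 1, HasDerivAt g (g' t) t)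
    (h : ∀ t ∈ Set.Icc (0 : ℝ) 1, 0 ≤ g' t) : ∀ t ∈ Set.Icc (0 : ℝ) 1, g 0 ≤ g t := by
  have hmono : MonotoneOn g (Set.Icc 0 1) := by
    refine monotoneOn_of_deriv_nonneg (convex_Icc 0 1)
      (fun t ht => (hg t ht).continuousAt.continuousWithinAt)
      (fun t ht => (hg t (interior_subset ht)).differentiableAt.differentiableWithinAt) ?_
    intro t ht
    rw [(hg t (interior_subset ht)).deriv]
    exact h t (interior_subset ht)
  exact fun t ht => hmono (Set.left_mem_Icc.2 zero_le_one) ht ht.1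

/-- A positive function with `-q' ≤ 2 q^{3/2}` decays at most quadratically. -/
lemma sq_div_le_of_deriv_ge_rpow {q q' : ℝ → ℝ}
    (hq : ∀ t ∈ Set.Icc (0 : ℝ) 1, HasDerivAt q (q' t) t)
    (hq0 : ∀ t ∈ Set.Icc (0 : ℝ) 1, 0 < q t)
    (hle : ∀ t ∈ Set.Icc (0 : ℝ) 1, -q' t ≤ 2 * (q t) ^ (3 / 2 : ℝ)) {r : ℝ} (hr : 0 < r)
    (h0 : q 0 = r ^ 2) : ∀ t ∈ Set.Icc (0 : ℝ) 1, r ^ 2 / (1 + r * t) ^ 2 ≤ q t := by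
  have hpow : ∀ t ∈ Set.Icc (0 : ℝ) 1, (q t) ^ (3 / 2 : ℝ) = q t * √(q t) := by
    intro t ht
    rw [Real.sqrt_eq_rpow]
    conv_rhs => rw [← Real.rpow_one (q t), ← Real.rpow_mul (hq0 t ht).le]
    rw [← Real.rpow_add (hq0 t ht)]
    norm_num
  -- The derivative of `q^{-1/2}` is `-q'/(2 q^{3/2}) ≤ 1`, so `t - q^{-1/2}` is nondecreasing.
  have hd : ∀ t ∈ Set.Icc (0 : ℝ) 1, HasDerivAt (fun t => t - (√(q t))⁻¹)
      (1 - -(q' t / (2 * √(q t))) / √(q t) ^ 2) t := fun t ht =>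
    (hasDerivAt_id t).sub (((hq t ht).sqrt (hq0 t ht).ne').inv (Real.sqrt_pos.2 (hq0 t ht)).ne')
  have key := le_of_hasDerivAt_nonneg hd (by
    intro t ht
    have hs := Real.sqrt_pos.2 (hq0 t ht)
    have h1 := hle t ht
    rw [hpow t ht] at h1
    rw [sub_nonneg, div_le_one (by positivity), ← neg_div, div_le_iff₀ (by positivity),
      Real.sq_sqrt (hq0 t ht).le]
    linarith)
  intro t ht
  have h1 := key t ht
  have hs := Real.sqrt_pos.2 (hq0 t ht)
  simp only [h0, Real.sqrt_sq hr.le, zero_sub] at h1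
  have h2 : (√(q t))⁻¹ ≤ (1 + r * t) / r := by
    rw [add_div, mul_div_cancel_left₀ _ hr.ne', one_div]; linarith
  have h3 : 0 < 1 + r * t := by have := mul_nonneg hr.le ht.1; linarith
  have h4 : r / (1 + r * t) ≤ √(q t) := by
    rw [inv_le_comm₀ hs (by positivity), inv_div] at h2
    exact h2
  calc r ^ 2 / (1 + r * t) ^ 2 = (r / (1 + r * t)) ^ 2 := (div_pow _ _ _).symm
    _ ≤ √(q t) ^ 2 := by gcongr
    _ = q t := Real.sq_sqrt (hq0 t ht).le

/-- The lower bound on a self-concordant function of one variable. -/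
lemma sub_log_le_of_selfConcordant {p p' q q' : ℝ → ℝ}
    (hp : ∀ t ∈ Set.Icc (0 : ℝ) 1, HasDerivAt p (p' t) t)
    (hp' : ∀ t ∈ Set.Icc (0 : ℝ) 1, HasDerivAt p' (q t) t)
    (hq : ∀ t ∈ Set.Icc (0 : ℝ) 1, HasDerivAt q (q' t) t)
    (hq0 : ∀ t ∈ Set.Icc (0 : ℝ) 1, 0 < q t)
    (hle : ∀ t ∈ Set.Icc (0 : ℝ) 1, -q' t ≤ 2 * (q t) ^ (3 / 2 : ℝ)) :
    √(q 0) - Real.log (1 + √(q 0)) ≤ p 1 - p 0 - p' 0 := by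
  set r := √(q 0)
  have h0m : (0 : ℝ) ∈ Set.Icc (0 : ℝ) 1 := by simp
  have hr : 0 < r := Real.sqrt_pos.2 (hq0 0 h0m)
  have hq' := sq_div_le_of_deriv_ge_rpow hq hq0 hle hr (Real.sq_sqrt (hq0 0 h0m).le).symm
  have hpos : ∀ t ∈ Set.Icc (0 : ℝ) 1, 0 < 1 + r * t := fun t ht => by
    have := mul_nonneg hr.le ht.1; linarith
  have hlin : ∀ t : ℝ, HasDerivAt (fun t => 1 + r * t) r t := fun t => by
    simpa using ((hasDerivAt_id t).const_mul r).const_add 1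
  -- The bound `r²/(1+rt)² ≤ q` is integrated once here and once more below, where the logarithm
  -- appears.
  have h1 : ∀ t ∈ Set.Icc (0 : ℝ) 1, p' 0 + r - r / (1 + r * t) ≤ p' t := by
    intro t ht
    have := le_of_hasDerivAt_nonneg (g := fun t => p' t + r * (1 + r * t)⁻¹)
      (fun t ht => (hp' t ht).add (((hlin t).inv (hpos t ht).ne').const_mul r)) (by
        intro t ht
        have := hq' t ht
        have e : r * (-r / (1 + r * t) ^ 2) = - (r ^ 2 / (1 + r * t) ^ 2) := by ring
        rw [e]; linarith) t ht
    simp only [mul_zero, add_zero, inv_one, mul_one] at this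
    rw [div_eq_mul_inv]; linarith
  have := le_of_hasDerivAt_nonneg
    (g := fun t => p t - (p' 0 + r) * t + Real.log (1 + r * t))
    (fun t ht => ((hp t ht).sub ((hasDerivAt_id t).const_mul (p' 0 + r))).add
      ((hlin t).log (hpos t ht).ne')) (by
        intro t ht
        have := h1 t ht
        linarith) 1 (by simp)
  simp only [mul_zero, mul_one, add_zero, sub_zero, Real.log_one] at this
  linarith

/-- The conjugate of `r - log (1+r)` is `-s - log (1-s)`: this is `log x ≤ x - 1` at `x =
(1+r)(1-s)`. For `s ≤ 1/2` it is at most `2s²`. -/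
lemma mul_sub_add_log_le {s r : ℝ} (hs : s ≤ 1 / 2) (hr : 0 ≤ r) :
    s * r - (r - Real.log (1 + r)) ≤ 2 * s ^ 2 := by
  have h1 : Real.log ((1 + r) * (1 - s)) ≤ (1 + r) * (1 - s) - 1 :=
    Real.log_le_sub_one_of_pos (by apply mul_pos <;> linarith)
  have h2 : Real.log (1 - s)⁻¹ ≤ (1 - s)⁻¹ - 1 :=
    Real.log_le_sub_one_of_pos (by apply inv_pos.2; linarith)
  rw [Real.log_mul (by linarith) (by linarith)] at h1
  rw [Real.log_inv] at h2
  have h3 : (1 - s)⁻¹ ≤ 1 + s + 2 * s ^ 2 := by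
    rw [inv_le_iff_one_le_mul₀ (by linarith)]
    nlinarith [sq_nonneg s, mul_nonneg (sq_nonneg s) (by linarith : (0 : ℝ) ≤ 1 - 2 * s)]
  nlinarith

end RealFunctions

/-! ### Self-concordant barriers along segments of the relative interior -/

section Barrier

variable {E : Type*} [NormedAddCommGroup E] [InnerProductSpace ℝ E] [FiniteDimensional ℝ E]
  {K : Set E} {F : E → ℝ}

lemma localRep_add (v : E) (k h : vectorSpan ℝ K) :
    localRep K F v (k + h) = localRep K F (v + k) h := by
  simp [localRep, add_assoc]

lemma iteratedFDeriv_localRep_add (n : ℕ) (v : E) (k : vectorSpan ℝ K) :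
    iteratedFDeriv ℝ n (localRep K F (v + k)) 0 = iteratedFDeriv ℝ n (localRep K F v) k := by
  have h := iteratedFDeriv_comp_add_left (𝕜 := ℝ) (f := localRep K F v) n k 0
  rw [add_zero] at h
  rw [← h]
  congr 1
  ext z
  exact (localRep_add v k z).symm

/-- Derivatives at moving base points are derivatives of one fixed local representative, centred at
time `t`, at the moving points `(s - t) d`. The chain rule then applies. -/
lemma hasDerivAt_iteratedFDeriv_localRep {v : E} {d : vectorSpan ℝ K} {t : ℝ} {k : ℕ} (hk : k < 3)
    (h : ContDiffAt ℝ 3 (localRep K F (v + t • (d : E))) 0) :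
    HasDerivAt (fun s : ℝ => iteratedFDeriv ℝ k (localRep K F (v + s • (d : E))) 0 (fun _ => d))
      (iteratedFDeriv ℝ (k + 1) (localRep K F (v + t • (d : E))) 0 (fun _ => d)) t := by
  set w := v + t • (d : E) with hw
  have e : (fun s : ℝ => iteratedFDeriv ℝ k (localRep K F (v + s • (d : E))) 0 (fun _ => d)) =
      fun s => iteratedFDeriv ℝ k (localRep K F w) ((s - t) • d) (fun _ => d) := by
    ext s
    have : v + s • (d : E) = w + (((s - t) • d : vectorSpan ℝ K) : E) := by
      rw [hw, Submodule.coe_smul, sub_smul]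
      abel
    rw [this, iteratedFDeriv_localRep_add]
  rw [e, iteratedFDeriv_succ_apply_left]
  have h1 : HasFDerivAt (iteratedFDeriv ℝ k (localRep K F w))
      (fderiv ℝ (iteratedFDeriv ℝ k (localRep K F w)) 0) ((t - t) • d) := by
    rw [sub_self, zero_smul]
    exact (h.differentiableAt_iteratedFDeriv (by exact_mod_cast hk)).hasFDerivAt
  have h2 : HasDerivAt (fun s : ℝ => (s - t) • d) d t := by
    simpa using ((hasDerivAt_id t).sub_const t).smul_const d
  have h3 := h1.comp_hasDerivAt t h2
  exact (ContinuousMultilinearMap.apply ℝ (fun _ : Fin k => vectorSpan ℝ K) ℝ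
    (fun _ => d)).hasFDerivAt.comp_hasDerivAt t h3

lemma inner_grad (v : E) (d : vectorSpan ℝ K) :
    inner ℝ (grad K F v) (d : E) = fderiv ℝ (localRep K F v) 0 d := by
  rw [grad, ← Submodule.coe_inner, gradient, InnerProductSpace.toDual_symm_apply]

lemma hasDerivAt_line {v : E} {d : vectorSpan ℝ K} {t : ℝ}
    (h : ContDiffAt ℝ 3 (localRep K F (v + t • (d : E))) 0) :
    HasDerivAt (fun s : ℝ => F (v + s • (d : E))) (inner ℝ (grad K F (v + t • (d : E))) (d : E)) t := by
  have := hasDerivAt_iteratedFDeriv_localRep (k := 0) (by norm_num) h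
  simpa [iteratedFDeriv_one_apply, inner_grad, localRep] using this

lemma hasDerivAt_inner_grad_line {v : E} {d : vectorSpan ℝ K} {t : ℝ}
    (h : ContDiffAt ℝ 3 (localRep K F (v + t • (d : E))) 0) :
    HasDerivAt (fun s : ℝ => inner ℝ (grad K F (v + s • (d : E))) (d : E))
      (hess K F (v + t • (d : E)) d) t := by
  have := hasDerivAt_iteratedFDeriv_localRep (k := 1) (by norm_num) h
  simp only [iteratedFDeriv_one_apply] at this
  simp only [inner_grad]
  exact this

lemma hasDerivAt_hess_line {v : E} {d : vectorSpan ℝ K} {t : ℝ}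
    (h : ContDiffAt ℝ 3 (localRep K F (v + t • (d : E))) 0) :
    HasDerivAt (fun s : ℝ => hess K F (v + s • (d : E)) d)
      (third K F (v + t • (d : E)) d) t :=
  hasDerivAt_iteratedFDeriv_localRep (k := 2) (by norm_num) h

lemma sub_mem_vectorSpan {v w : E} (hv : v ∈ intrinsicInterior ℝ K)
    (hw : w ∈ intrinsicInterior ℝ K) : w - v ∈ vectorSpan ℝ K :=
  vsub_mem_vectorSpan ℝ (intrinsicInterior_subset hw) (intrinsicInterior_subset hv)

lemma isOpen_setOf_add_mem_intrinsicInterior {v : E} (hv : v ∈ K) :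
    IsOpen {h : vectorSpan ℝ K | v + (h : E) ∈ intrinsicInterior ℝ K} := by
  have hmem : ∀ h : vectorSpan ℝ K, v + (h : E) ∈ affineSpan ℝ K := fun h => by
    rw [add_comm]
    exact AffineSubspace.vadd_mem_of_mem_direction
      (by rw [direction_affineSpan]; exact h.2) (subset_affineSpan ℝ K hv)
  have hc : Continuous (fun h : vectorSpan ℝ K => (⟨v + (h : E), hmem h⟩ : affineSpan ℝ K)) := by
    fun_prop
  have : {h : vectorSpan ℝ K | v + (h : E) ∈ intrinsicInterior ℝ K} =
      (fun h : vectorSpan ℝ K => (⟨v + (h : E), hmem h⟩ : affineSpan ℝ K)) ⁻¹'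
        interior ((↑) ⁻¹' K) := by
    ext h
    simp only [intrinsicInterior, Set.mem_ofPred_eq, Set.mem_image, Set.mem_preimage]
    constructor
    · rintro ⟨y, hy, e⟩
      have : y = ⟨v + (h : E), hmem h⟩ := Subtype.ext e
      rwa [← this]
    · exact fun hh => ⟨_, hh, rfl⟩
  rw [this]
  exact isOpen_interior.preimage hc

lemma line_mem {v : E} {d : E} (hconv : Convex ℝ (intrinsicInterior ℝ K))
    (hv : v ∈ intrinsicInterior ℝ K) (hd : v + d ∈ intrinsicInterior ℝ K) {t : ℝ}
    (ht : t ∈ Set.Icc (0 : ℝ) 1) : v + t • d ∈ intrinsicInterior ℝ K := by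
  have := hconv.add_smul_sub_mem hv hd ht
  simpa using this

lemma exists_smul_add_mem {v : E} (hv : v ∈ intrinsicInterior ℝ K) (d : vectorSpan ℝ K) :
    ∃ ε : ℝ, 0 < ε ∧ v + ((ε • d : vectorSpan ℝ K) : E) ∈ intrinsicInterior ℝ K := by
  have ho := isOpen_setOf_add_mem_intrinsicInterior (intrinsicInterior_subset hv)
  have hc : Continuous (fun t : ℝ => t • d) := by fun_prop
  have hm : (fun t : ℝ => t • d) ⁻¹'
      {h : vectorSpan ℝ K | v + (h : E) ∈ intrinsicInterior ℝ K} ∈ nhds (0 : ℝ) :=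
    (ho.preimage hc).mem_nhds (by simpa using hv)
  obtain ⟨ε, hε, hb⟩ := Metric.mem_nhds_iff.1 hm
  refine ⟨ε / 2, by positivity, hb ?_⟩
  rw [Metric.mem_ball, Real.dist_eq, sub_zero, abs_of_pos (by positivity)]
  linarith

lemma hess_smul (v : E) (c : ℝ) (d : vectorSpan ℝ K) :
    hess K F v (c • d) = c ^ 2 * hess K F v d := by
  have := (iteratedFDeriv ℝ 2 (localRep K F v) 0).map_smul_univ (fun _ => c) (fun _ => d)
  simpa [hess] using this

lemma third_neg (v : E) (d : vectorSpan ℝ K) : third K F v (-d) = - third K F v d := by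
  have := (iteratedFDeriv ℝ 3 (localRep K F v) 0).map_smul_univ (fun _ => -1) (fun _ => d)
  simpa [third, pow_succ] using this

lemma hess_neg (v : E) (d : vectorSpan ℝ K) : hess K F v (-d) = hess K F v d := by
  simpa using hess_smul (F := F) v (-1) d

/-- The third derivative is odd in the direction and the second is even, so the one-sided bound
holds for both signs. -/
lemma IsSelfConcordantBarrier.neg_third_le (hF : IsSelfConcordantBarrier K F) {v : E}
    (hv : v ∈ intrinsicInterior ℝ K) (d : vectorSpan ℝ K) :
    - third K F v d ≤ 2 * (hess K F v d) ^ (3 / 2 : ℝ) := by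
  have := hF.selfConcordant v hv (-d)
  rwa [third_neg, hess_neg] at this

lemma IsSelfConcordantBarrier.hess_nonneg (hF : IsSelfConcordantBarrier K F) {v : E}
    (hv : v ∈ intrinsicInterior ℝ K) (d : vectorSpan ℝ K) : 0 ≤ hess K F v d := by
  -- Nonnegativity is invariant under scaling, so `d` may be shortened until the segment stays in
  -- the relative interior. There the slope of a convex function is monotone.
  obtain ⟨ε, hε, hm⟩ := exists_smul_add_mem hv d
  suffices h : 0 ≤ hess K F v (ε • d) by
    rw [hess_smul] at h
    exact nonneg_of_mul_nonneg_right h (by positivity)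
  set e := ε • d
  have hmem : ∀ t ∈ Set.Icc (0 : ℝ) 1, v + t • (e : E) ∈ intrinsicInterior ℝ K :=
    fun t ht => line_mem hF.convex.1 hv hm ht
  have hconv : ConvexOn ℝ (Set.Icc (0 : ℝ) 1) (fun t : ℝ => F (v + t • (e : E))) := by
    have := hF.convex.comp_affineMap (AffineMap.lineMap v (v + (e : E)) : ℝ →ᵃ[ℝ] E)
    refine ConvexOn.congr (this.subset ?_ (convex_Icc 0 1)) ?_
    · intro t ht
      simpa [AffineMap.lineMap_apply, add_comm] using hmem t ht
    · intro t _
      simp [AffineMap.lineMap_apply, add_comm]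
  have hd : ∀ t ∈ Set.Icc (0 : ℝ) 1, HasDerivAt (fun t : ℝ => F (v + t • (e : E))) _ t :=
    fun t ht => hasDerivAt_line (hF.smooth _ (hmem t ht))
  have hmono := hconv.monotoneOn_deriv (fun t ht => (hd t ht).differentiableAt)
  have h0 : (0 : ℝ) ∈ Set.Icc (0 : ℝ) 1 := by simp
  have hmono' : MonotoneOn (fun s : ℝ => inner ℝ (grad K F (v + s • (e : E))) (e : E))
      (Set.Icc (0 : ℝ) 1) := hmono.congr (fun t ht => (hd t ht).deriv)
  have h2 := (hasDerivAt_inner_grad_line (hF.smooth _ (hmem 0 h0))).hasDerivWithinAt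
    (s := Set.Icc (0 : ℝ) 1)
  have h3 := h2.derivWithin (uniqueDiffOn_Icc one_pos 0 h0)
  have h4 := hmono'.derivWithin_nonneg (x := 0)
  rw [h3] at h4
  simpa using h4

/-- Strict convexity alone does not make the Hessian definite. By self-concordance, a zero of
`∇²F[d,d]` at one point spreads along the segment in direction `d`; there `F` would be affine. -/
lemma IsSelfConcordantBarrier.eq_zero_of_hess_eq_zero (hF : IsSelfConcordantBarrier K F)
    (hs : StrictConvexOn ℝ (intrinsicInterior ℝ K) F) {v : E} (hv : v ∈ intrinsicInterior ℝ K)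
    {d : vectorSpan ℝ K} (h : hess K F v d = 0) : d = 0 := by
  obtain ⟨ε, hε, hm⟩ := exists_smul_add_mem hv d
  have he : hess K F v (ε • d) = 0 := by rw [hess_smul, h, mul_zero]
  by_contra hd
  have hed : ε • d ≠ 0 := smul_ne_zero hε.ne' hd
  set e := ε • d
  have hmem : ∀ t ∈ Set.Icc (0 : ℝ) 1, v + t • (e : E) ∈ intrinsicInterior ℝ K :=
    fun t ht => line_mem hF.convex.1 hv hm ht
  have hq : ∀ t ∈ Set.Icc (0 : ℝ) 1, hess K F (v + t • (e : E)) e = 0 :=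
    eq_zero_of_deriv_le_rpow (fun t ht => hasDerivAt_hess_line (hF.smooth _ (hmem t ht)))
      (fun t ht => hF.hess_nonneg (hmem t ht) e) (fun t ht => hF.selfConcordant _ (hmem t ht) e)
      (by simpa using he)
  have hg : ∀ t ∈ Set.Icc (0 : ℝ) 1, inner ℝ (grad K F (v + t • (e : E))) (e : E) =
      inner ℝ (grad K F v) (e : E) := by
    have h1 : ∀ t ∈ Set.Icc (0 : ℝ) 1, HasDerivAt
      (fun s : ℝ => inner ℝ (grad K F (v + s • (e : E))) (e : E)) 0 t := fun t ht => by
        have := hasDerivAt_inner_grad_line (hF.smooth _ (hmem t ht))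
        rwa [hq t ht] at this
    intro t ht
    have a := le_of_hasDerivAt_nonneg h1 (fun _ _ => le_rfl) t ht
    have b := le_of_hasDerivAt_nonneg (fun t ht => (h1 t ht).neg) (fun _ _ => by simp) t ht
    simp only [zero_smul, add_zero, Pi.neg_apply] at a b
    linarith
  have hl : ∀ t ∈ Set.Icc (0 : ℝ) 1, F (v + t • (e : E)) =
      F v + t * inner ℝ (grad K F v) (e : E) := by
    have h1 : ∀ t ∈ Set.Icc (0 : ℝ) 1, HasDerivAt
      (fun s : ℝ => F (v + s • (e : E)) - s * inner ℝ (grad K F v) (e : E)) 0 t := fun t ht => by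
        have := (hasDerivAt_line (hF.smooth _ (hmem t ht))).sub
          ((hasDerivAt_id t).mul_const (inner ℝ (grad K F v) (e : E)))
        rw [hg t ht] at this
        exact this.congr_deriv (by simp)
    intro t ht
    have a := le_of_hasDerivAt_nonneg h1 (fun _ _ => le_rfl) t ht
    have b := le_of_hasDerivAt_nonneg (fun t ht => (h1 t ht).neg) (fun _ _ => by simp) t ht
    simp only [zero_smul, add_zero, zero_mul, sub_zero, Pi.neg_apply] at a b
    linarith
  have hne : v ≠ v + (e : E) := by
    intro h'
    apply hed
    simpa using h'
  have := hs.2 hv hm hne (show (0 : ℝ) < 1 / 2 by norm_num) (show (0 : ℝ) < 1 / 2 by norm_num)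
    (by norm_num)
  have e1 : (1 / 2 : ℝ) • v + (1 / 2 : ℝ) • (v + (e : E)) = v + (1 / 2 : ℝ) • (e : E) := by
    rw [smul_add, ← add_assoc, ← add_smul]; norm_num
  have e2 := hl 1 (by simp)
  rw [one_smul] at e2
  rw [e1, hl (1 / 2) ⟨by norm_num, by norm_num⟩, e2] at this
  simp only [smul_eq_mul] at this
  linarith

/-- The lower bound `D_F(w,v) ≥ r - log (1 + r)` where `r` is the local norm of `w - v` at `v`. -/
lemma IsSelfConcordantBarrier.sub_log_le_bregman (hF : IsSelfConcordantBarrier K F)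
    (hs : StrictConvexOn ℝ (intrinsicInterior ℝ K) F) {v : E} (hv : v ∈ intrinsicInterior ℝ K)
    (d : vectorSpan ℝ K) (hd : v + (d : E) ∈ intrinsicInterior ℝ K) :
    √(hess K F v d) - Real.log (1 + √(hess K F v d)) ≤ bregman K F (v + (d : E)) v := by
  by_cases h0 : d = 0
  · subst h0
    have : hess K F v 0 = 0 := by simpa using hess_smul (F := F) v 0 0
    simp [this, bregman]
  have hmem : ∀ t ∈ Set.Icc (0 : ℝ) 1, v + t • (d : E) ∈ intrinsicInterior ℝ K :=
    fun t ht => line_mem hF.convex.1 hv hd ht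
  have := sub_log_le_of_selfConcordant
    (fun t ht => hasDerivAt_line (hF.smooth _ (hmem t ht)))
    (fun t ht => hasDerivAt_inner_grad_line (hF.smooth _ (hmem t ht)))
    (fun t ht => hasDerivAt_hess_line (hF.smooth _ (hmem t ht)))
    (fun t ht => lt_of_le_of_ne (hF.hess_nonneg (hmem t ht) d)
      (fun h => h0 (hF.eq_zero_of_hess_eq_zero hs (hmem t ht) h.symm)))
    (fun t ht => hF.neg_third_le (hmem t ht) d)
  simpa [bregman] using this

lemma IsSelfConcordantBarrier.bregman_nonneg (hF : IsSelfConcordantBarrier K F)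
    (hs : StrictConvexOn ℝ (intrinsicInterior ℝ K) F) {v w : E} (hv : v ∈ intrinsicInterior ℝ K)
    (hw : w ∈ intrinsicInterior ℝ K) : 0 ≤ bregman K F w v := by
  have h := hF.sub_log_le_bregman hs hv ⟨w - v, sub_mem_vectorSpan hv hw⟩ (by simpa using hw)
  rw [add_sub_cancel] at h
  refine le_trans ?_ h
  set r := √(hess K F v ⟨w - v, sub_mem_vectorSpan hv hw⟩)
  have hr : 0 ≤ r := Real.sqrt_nonneg _
  have := Real.log_le_sub_one_of_pos (show 0 < 1 + r by linarith)
  linarith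

end Barrier

/-! ### Legendre duality, the Hessian of the dual and the mirror step -/

section Dual

/-- The Hessian operator is the derivative of the gradient. -/
lemma hasStrictFDerivAt_gradient {V : Type*} [NormedAddCommGroup V] [InnerProductSpace ℝ V]
    [CompleteSpace V] {A : V → ℝ} {L : V →L[ℝ] V →L[ℝ] ℝ} {a : V}
    (h : HasStrictFDerivAt (fderiv ℝ A) L a) :
    ∃ H : V →L[ℝ] V, (∀ d e, inner ℝ (H d) e = L d e) ∧ HasStrictFDerivAt (gradient A) H a := by
  let J : (V →L[ℝ] ℝ) →L[ℝ] V := LinearMap.mkContinuous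
    { toFun := fun l => (InnerProductSpace.toDual ℝ V).symm l
      map_add' := fun l m => map_add _ l m
      map_smul' := fun c l => by simp } 1 (fun l => by simp)
  refine ⟨J ∘L L, fun d e => InnerProductSpace.toDual_symm_apply, ?_⟩
  exact (J.hasStrictFDerivAt (x := fderiv ℝ A a)).comp a h

variable {E : Type*} [NormedAddCommGroup E] [InnerProductSpace ℝ E] [FiniteDimensional ℝ E]
  {K : Set E} {F : E → ℝ}

/-- The orthogonal projection onto the direction space of the affine hull of `K`. -/
def dirProj (K : Set E) : E →L[ℝ] vectorSpan ℝ K := (vectorSpan ℝ K).orthogonalProjectionOnto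

lemma inner_dirProj (d : vectorSpan ℝ K) (h : E) : inner ℝ (dirProj K h) d = inner ℝ h (d : E) :=
  Submodule.inner_orthogonalProjectionOnto_eq_of_mem_right d h

lemma dirProj_coe (d : vectorSpan ℝ K) : dirProj K (d : E) = d :=
  Submodule.orthogonalProjectionOnto_mem_subspace_eq_self d

lemma gradient_localRep (v : E) (a : vectorSpan ℝ K) :
    gradient (localRep K F v) a = gradient (localRep K F (v + a)) 0 := by
  have h := fderiv_comp_add_left (𝕜 := ℝ) (f := localRep K F v) (x := 0) a
  rw [add_zero] at h
  rw [gradient, gradient, ← h]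
  congr 2
  ext z
  exact localRep_add v a z

/-- The point of the relative interior at which `F` has the gradient `h`, projected onto the
direction space. -/
def dualPoint (K : Set E) (F : E → ℝ) (h : E) : E :=
  Function.invFunOn (grad K F) (intrinsicInterior ℝ K) (dirProj K h : E)

namespace IsRegularizer

lemma dualPoint_mem (hF : IsRegularizer K F) (h : E) :
    dualPoint K F h ∈ intrinsicInterior ℝ K :=
  Function.invFunOn_mem (hF.bijOn_grad.surjOn (dirProj K h).2)

lemma grad_dualPoint (hF : IsRegularizer K F) (h : E) :
    grad K F (dualPoint K F h) = (dirProj K h : E) :=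
  Function.invFunOn_eq (hF.bijOn_grad.surjOn (dirProj K h).2)

lemma dualPoint_grad (hF : IsRegularizer K F) {v : E} (hv : v ∈ intrinsicInterior ℝ K) :
    dualPoint K F (grad K F v) = v := by
  refine hF.bijOn_grad.injOn (hF.dualPoint_mem _) hv ?_
  rw [grad_dualPoint hF, grad, dirProj_coe]

lemma dualPoint_dirProj (h : E) : dualPoint K F (dirProj K h : E) = dualPoint K F h := by
  rw [dualPoint, dirProj_coe, dualPoint]

/-- The value at `z` falls short of the value at the dual point by exactly the Bregman divergence
between them, because `h` acts on differences of points only through its projection. -/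
lemma isGreatest_dual (hF : IsRegularizer K F) (h : E) :
    IsGreatest ((fun v => inner ℝ h v - F v) '' intrinsicInterior ℝ K)
      (inner ℝ h (dualPoint K F h) - F (dualPoint K F h)) := by
  refine ⟨⟨_, hF.dualPoint_mem h, rfl⟩, ?_⟩
  rintro _ ⟨z, hz, rfl⟩
  have h1 := hF.selfConcordantBarrier.bregman_nonneg hF.strictConvex (hF.dualPoint_mem h) hz
  have h2 := inner_dirProj ⟨z - dualPoint K F h, sub_mem_vectorSpan (hF.dualPoint_mem h) hz⟩ h
  rw [Submodule.coe_inner] at h2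
  rw [bregman, hF.grad_dualPoint, h2, inner_sub_right] at h1
  simp only
  linarith

lemma dual_eq (hF : IsRegularizer K F) (h : E) :
    dual K F h = inner ℝ h (dualPoint K F h) - F (dualPoint K F h) :=
  (hF.isGreatest_dual h).csSup_eq

lemma sub_le_dual (hF : IsRegularizer K F) (h : E) {z : E} (hz : z ∈ intrinsicInterior ℝ K) :
    inner ℝ h z - F z ≤ dual K F h := by
  rw [hF.dual_eq]
  exact (hF.isGreatest_dual h).2 ⟨z, hz, rfl⟩

/-- The Hessian operator of `F` at `v`, and the derivative of the inverse of the gradient. -/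
lemma exists_hessian_equiv (hF : IsRegularizer K F) (h : E) :
    ∃ H : vectorSpan ℝ K ≃L[ℝ] vectorSpan ℝ K,
      (∀ d, inner ℝ (H d) d = hess K F (dualPoint K F h) d) ∧
      (∀ d e, inner ℝ (H d) e = inner ℝ (H e) d) ∧
      HasFDerivAt (dualPoint K F)
        ((vectorSpan ℝ K).subtypeL ∘L (H.symm : vectorSpan ℝ K →L[ℝ] vectorSpan ℝ K) ∘L dirProj K)
        h := by
  set v := dualPoint K F h with hvdef
  have hv : v ∈ intrinsicInterior ℝ K := hF.dualPoint_mem h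
  set A := localRep K F v with hA
  have hsm : ContDiffAt ℝ 3 A 0 := hF.selfConcordantBarrier.smooth v hv
  have hsm2 : ContDiffAt ℝ 2 (fderiv ℝ A) 0 := hsm.fderiv_right (by norm_num)
  have hstrict : HasStrictFDerivAt (fderiv ℝ A) (fderiv ℝ (fderiv ℝ A) 0) 0 :=
    hsm2.hasStrictFDerivAt (by norm_num)
  obtain ⟨H0, hH0, hgrad⟩ := hasStrictFDerivAt_gradient hstrict
  have hdiag : ∀ d, inner ℝ (H0 d) d = hess K F v d := fun d => by
    rw [hH0, hess, iteratedFDeriv_two_apply]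
  have hinj : Function.Injective (H0 : vectorSpan ℝ K →ₗ[ℝ] vectorSpan ℝ K) := by
    rw [← LinearMap.ker_eq_bot, LinearMap.ker_eq_bot']
    intro d hd
    refine hF.selfConcordantBarrier.eq_zero_of_hess_eq_zero hF.strictConvex hv ?_
    have hd' : H0 d = 0 := hd
    rw [← hdiag, hd', inner_zero_left]
  let H : vectorSpan ℝ K ≃L[ℝ] vectorSpan ℝ K :=
    (LinearEquiv.ofInjectiveEndo _ hinj).toContinuousLinearEquiv
  have hHapp : ∀ d, H d = H0 d := fun d => rfl
  have hHcoe : (H : vectorSpan ℝ K →L[ℝ] vectorSpan ℝ K) = H0 := by ext d; rw [← hHapp]; rfl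
  refine ⟨H, fun d => by rw [hHapp, hdiag], fun d e => ?_, ?_⟩
  · rw [hHapp, hHapp, hH0, hH0]
    exact (hsm.isSymmSndFDerivAt (by simp; norm_num)).eq d e
  · let g : vectorSpan ℝ K → vectorSpan ℝ K := fun k =>
      ⟨dualPoint K F (k : E) - v, sub_mem_vectorSpan hv (hF.dualPoint_mem _)⟩
    -- A local left inverse of a map with invertible strict derivative is differentiable, with the
    -- inverse derivative.
    have hleft : ∀ᶠ a in nhds (0 : vectorSpan ℝ K), g (gradient A a) = a := by
      have := (isOpen_setOf_add_mem_intrinsicInterior (intrinsicInterior_subset hv)).mem_nhds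
        (x := 0) (by simpa using hv)
      filter_upwards [this] with a ha
      apply Subtype.ext
      have e : ((gradient A a : vectorSpan ℝ K) : E) = grad K F (v + a) := by
        rw [hA, gradient_localRep, grad]
      change dualPoint K F (gradient A a : vectorSpan ℝ K) - v = a
      rw [e, hF.dualPoint_grad ha, add_sub_cancel_left]
    have hg := (show HasStrictFDerivAt (gradient A)
      (H : vectorSpan ℝ K →L[ℝ] vectorSpan ℝ K) 0 by rwa [hHcoe]).to_local_left_inverse hleft
    have e0 : gradient A 0 = dirProj K h := by
      apply Subtype.ext
      rw [← hF.grad_dualPoint h, ← hvdef, grad]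
    rw [e0] at hg
    have h1 := (hg.hasFDerivAt.comp h (dirProj K).hasFDerivAt)
    have h2 := ((vectorSpan ℝ K).subtypeL.hasFDerivAt.comp h h1).const_add v
    refine h2.congr_of_eventuallyEq (Filter.Eventually.of_forall fun k => ?_)
    simp [g, dualPoint_dirProj]

/-- Optimality of the maximizers `x_h` and `x_k` gives `0 ≤ F*(k) - F*(h) - ⟨k-h,x_h⟩ ≤
⟨k-h,x_k-x_h⟩`, which is `o(‖k-h‖)` by continuity of the maximizer. -/
lemma hasFDerivAt_dual (hF : IsRegularizer K F) (h : E) :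
    HasFDerivAt (dual K F) (innerSL ℝ (dualPoint K F h)) h := by
  obtain ⟨H, -, -, hd⟩ := hF.exists_hessian_equiv h
  rw [hasFDerivAt_iff_isLittleO, Asymptotics.isLittleO_iff]
  intro c hc
  filter_upwards [Metric.continuousAt_iff'.1 hd.continuousAt c hc] with k hk
  have h1 := hF.sub_le_dual k (hF.dualPoint_mem h)
  have h2 := hF.sub_le_dual h (hF.dualPoint_mem k)
  have e1 := hF.dual_eq h
  have e2 := hF.dual_eq k
  have e3 : innerSL ℝ (dualPoint K F h) (k - h) =
      inner ℝ k (dualPoint K F h) - inner ℝ h (dualPoint K F h) := by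
    rw [innerSL_apply_apply, real_inner_comm, inner_sub_left]
  have e4 : inner ℝ (k - h) (dualPoint K F k - dualPoint K F h) =
      inner ℝ k (dualPoint K F k) - inner ℝ h (dualPoint K F k)
      - (inner ℝ k (dualPoint K F h) - inner ℝ h (dualPoint K F h)) := by
    rw [inner_sub_right, inner_sub_left, inner_sub_left]
  rw [e3, Real.norm_eq_abs, abs_of_nonneg (by linarith)]
  calc _ ≤ inner ℝ (k - h) (dualPoint K F k - dualPoint K F h) := by rw [e4]; linarith
    _ ≤ ‖k - h‖ * ‖dualPoint K F k - dualPoint K F h‖ := real_inner_le_norm _ _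
    _ ≤ ‖k - h‖ * c := by
      gcongr
      rw [← dist_eq_norm]; exact hk.le
    _ = c * ‖k - h‖ := mul_comm _ _

/-- This is needed on all of `E`: the argument `∇F(v) - ρ f` of a mirror step may leave the
direction space. -/
lemma gradient_dual (hF : IsRegularizer K F) (h : E) :
    gradient (dual K F) h = dualPoint K F h := by
  rw [gradient, (hF.hasFDerivAt_dual h).fderiv]
  exact (InnerProductSpace.toDual ℝ E).symm_apply_apply _

/-- The Cauchy–Schwarz inequality between the local norm and its dual. -/
lemma inner_le_dualLocalNorm_mul (hF : IsRegularizer K F) (h f : E) (d : vectorSpan ℝ K) :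
    inner ℝ f (d : E) ≤ dualLocalNorm K F h f * √(hess K F (dualPoint K F h) d) := by
  obtain ⟨H, hdiag, hsymm, hd⟩ := hF.exists_hessian_equiv h
  have hnn : ∀ e, 0 ≤ inner ℝ (H e) e := fun e => by
    rw [hdiag]; exact hF.selfConcordantBarrier.hess_nonneg (hF.dualPoint_mem h) e
  have hdual : iteratedFDeriv ℝ 2 (dual K F) h (fun _ => f) =
      inner ℝ (H.symm (dirProj K f)) (dirProj K f) := by
    have e : fderiv ℝ (dual K F) = fun k => innerSL ℝ (dualPoint K F k) :=
      funext fun k => (hF.hasFDerivAt_dual k).fderiv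
    have hd2 : HasFDerivAt (fun k => innerSL ℝ (dualPoint K F k)) _ h :=
      (innerSL ℝ : E →L[ℝ] E →L[ℝ] ℝ).hasFDerivAt.comp h hd
    rw [iteratedFDeriv_two_apply, e, hd2.fderiv, real_inner_comm, inner_dirProj, real_inner_comm]
    rfl
  let B : LinearMap.BilinForm ℝ (vectorSpan ℝ K) :=
    (innerₗ (vectorSpan ℝ K)) ∘ₗ (H : vectorSpan ℝ K →ₗ[ℝ] vectorSpan ℝ K)
  have hB : ∀ x y, B x y = inner ℝ (H x) y := fun _ _ => rfl
  -- Cauchy–Schwarz for the form of `∇²F` is applied to `d` and `y = H⁻¹f`, whose squared norm in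
  -- this form is the squared dual norm of `f`.
  set y := H.symm (dirProj K f)
  have hy : H y = dirProj K f := H.apply_symm_apply _
  have hcs := B.apply_mul_apply_le_of_forall_zero_le (fun x => by rw [hB]; exact hnn x) y d
  rw [hB, hB, hB, hB, hsymm d y, hdiag d, hy, inner_dirProj] at hcs
  rw [dualLocalNorm, hdual, ← Real.sqrt_mul (by rw [real_inner_comm, ← hy]; exact hnn y)]
  exact Real.le_sqrt_of_sq_le (by rwa [sq, real_inner_comm (dirProj K f) y])

/-- One step of mirror descent with a self-concordant regularizer. -/
lemma mirror_step (hF : IsRegularizer K F) {v w z f : E} {ρ : ℝ} (hρ : 0 ≤ ρ)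
    (hv : v ∈ intrinsicInterior ℝ K) (hz : z ∈ intrinsicInterior ℝ K)
    (hw : w = gradient (dual K F) (grad K F v - ρ • f))
    (hs : ρ * dualLocalNorm K F (grad K F v) f ≤ 1 / 2) :
    w ∈ intrinsicInterior ℝ K ∧
    ρ * inner ℝ f (v - z) ≤ bregman K F z v - bregman K F z w
      + 2 * (ρ * dualLocalNorm K F (grad K F v) f) ^ 2 := by
  rw [hF.gradient_dual] at hw
  have hwm : w ∈ intrinsicInterior ℝ K := hw ▸ hF.dualPoint_mem _
  refine ⟨hwm, ?_⟩
  have hgw : ∀ d : vectorSpan ℝ K,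
      inner ℝ (grad K F w) (d : E) = inner ℝ (grad K F v) (d : E) - ρ * inner ℝ f (d : E) := by
    intro d
    rw [hw, hF.grad_dualPoint, ← Submodule.coe_inner, inner_dirProj, inner_sub_left,
      real_inner_smul_left]
  have g1 := hgw ⟨v - z, sub_mem_vectorSpan hz hv⟩
  have g2 := hgw ⟨w - v, sub_mem_vectorSpan hv hwm⟩
  have g3 := hF.inner_le_dualLocalNorm_mul (grad K F v) f
    (-⟨w - v, sub_mem_vectorSpan hv hwm⟩)
  rw [hF.dualPoint_grad hv, hess_neg] at g3
  have g4 := hF.selfConcordantBarrier.sub_log_le_bregman hF.strictConvex hv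
    ⟨w - v, sub_mem_vectorSpan hv hwm⟩ (by simpa using hwm)
  simp only [add_sub_cancel, Submodule.coe_neg] at g1 g2 g3 g4
  set r := √(hess K F v ⟨w - v, sub_mem_vectorSpan hv hwm⟩)
  have g5 := mul_sub_add_log_le hs (Real.sqrt_nonneg _ : 0 ≤ r)
  have g6 := mul_le_mul_of_nonneg_left g3 hρ
  simp only [bregman] at g4 ⊢
  simp only [inner_sub_right, inner_neg_right] at g1 g2 g4 g6 ⊢
  -- The relations `g1` and `g2` yield the three-point identity; the remainder `ρ⟨f,v-w⟩ - D(w,v)`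
  -- is bounded by `g4`, `g5` and `g6`.
  nlinarith

end IsRegularizer

end Dual

/-! ### The `ℓ¹` distance between distributions -/

section TotalVariation

variable {S : Type*} [Fintype S]

lemma tv_nonneg (μ₁ μ₂ : S → ℝ) : 0 ≤ tv μ₁ μ₂ := Finset.sum_nonneg fun _ _ => abs_nonneg _

lemma tv_triangle (μ₁ μ₂ μ₃ : S → ℝ) : tv μ₁ μ₃ ≤ tv μ₁ μ₂ + tv μ₂ μ₃ := by
  rw [tv, tv, tv, ← Finset.sum_add_distrib]
  exact Finset.sum_le_sum fun s _ => abs_sub_le _ _ _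

lemma tv_le_two {μ₁ μ₂ : S → ℝ} (h₁ : IsDist μ₁) (h₂ : IsDist μ₂) : tv μ₁ μ₂ ≤ 2 := by
  calc tv μ₁ μ₂ ≤ ∑ s, (μ₁ s + μ₂ s) := Finset.sum_le_sum fun s _ => by
        rw [abs_le]; constructor <;> linarith [h₁.1 s, h₂.1 s]
    _ = 2 := by rw [Finset.sum_add_distrib, h₁.2, h₂.2]; norm_num

lemma eq_of_tv_nonpos {μ₁ μ₂ : S → ℝ} (h : tv μ₁ μ₂ ≤ 0) : μ₁ = μ₂ := by
  have h0 := le_antisymm h (tv_nonneg _ _)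
  rw [tv, Finset.sum_eq_zero_iff_of_nonneg fun _ _ => abs_nonneg _] at h0
  ext s
  simpa [sub_eq_zero] using h0 s (Finset.mem_univ s)

end TotalVariation

/-! ### Invariant distributions, mixing and the state-action polytope -/

section Chain

variable {X U : Type*} [Fintype X] [Fintype U] {K : X → U → X → ℝ} {P Q : X → U → ℝ}

lemma stateKernel_nonneg (hK : IsTransitionKernel K) (hP : IsPolicy P) (x y : X) :
    0 ≤ stateKernel K P x y :=
  Finset.sum_nonneg fun u _ => mul_nonneg ((hK x u).1 y) ((hP x).1 u)

lemma sum_stateKernel (hK : IsTransitionKernel K) (hP : IsPolicy P) (x : X) :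
    ∑ y, stateKernel K P x y = 1 := by
  simp only [stateKernel]
  rw [Finset.sum_comm]
  simp_rw [← Finset.sum_mul, (hK x _).2, one_mul, (hP x).2]

lemma isDist_push (hK : IsTransitionKernel K) (hP : IsPolicy P) {μ : X → ℝ} (hμ : IsDist μ) :
    IsDist (push K P μ) := by
  refine ⟨fun y => Finset.sum_nonneg fun x _ =>
    mul_nonneg (hμ.1 x) (stateKernel_nonneg hK hP x y), ?_⟩
  simp only [push]
  rw [Finset.sum_comm]
  simp_rw [← Finset.mul_sum, sum_stateKernel hK hP, mul_one, hμ.2]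

lemma tv_push_le_of_policy (hK : IsTransitionKernel K) {μ : X → ℝ} (hμ : IsDist μ) {δ : ℝ}
    (hδ : ∀ x, tv (P x) (Q x) ≤ δ) : tv (push K P μ) (push K Q μ) ≤ δ := by
  calc tv (push K P μ) (push K Q μ)
      ≤ ∑ y, ∑ x, μ x * ∑ u, K x u y * |P x u - Q x u| := by
        refine Finset.sum_le_sum fun y _ => ?_
        simp only [push, stateKernel]
        rw [← Finset.sum_sub_distrib]
        refine (Finset.abs_sum_le_sum_abs _ _).trans (Finset.sum_le_sum fun x _ => ?_)
        rw [← mul_sub, abs_mul, abs_of_nonneg (hμ.1 x), ← Finset.sum_sub_distrib]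
        refine mul_le_mul_of_nonneg_left ?_ (hμ.1 x)
        refine (Finset.abs_sum_le_sum_abs _ _).trans (Finset.sum_le_sum fun u _ => ?_)
        rw [← mul_sub, abs_mul, abs_of_nonneg ((hK x u).1 y)]
    _ = ∑ x, μ x * tv (P x) (Q x) := by
        rw [Finset.sum_comm]
        refine Finset.sum_congr rfl fun x _ => ?_
        rw [← Finset.mul_sum, Finset.sum_comm, tv]
        simp_rw [← Finset.sum_mul, (hK x _).2, one_mul]
    _ ≤ ∑ x, μ x * δ := Finset.sum_le_sum fun x _ => mul_le_mul_of_nonneg_left (hδ x) (hμ.1 x)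
    _ = δ := by rw [← Finset.sum_mul, hμ.2, one_mul]

/-- With the ratio `τ/(τ+1)` the geometric series sums to `τ+1`, the constant of the theorem. -/
lemma exp_neg_inv_le {τ : ℝ} (hτ : 0 < τ) : Real.exp (-1 / τ) ≤ τ / (τ + 1) := by
  have h := Real.add_one_le_exp (1 / τ)
  rw [neg_div, Real.exp_neg, inv_le_comm₀ (Real.exp_pos _) (by positivity), inv_div]
  refine le_trans (le_of_eq ?_) h
  field_simp
  ring

lemma UniformMixing.mul_tv_push_le {τ : ℝ} (hmix : UniformMixing K τ) (hτ : 0 < τ)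
    (hP : IsPolicy P) {μ₁ μ₂ : X → ℝ} (h₁ : IsDist μ₁) (h₂ : IsDist μ₂) :
    (τ + 1) * tv (push K P μ₁) (push K P μ₂) ≤ τ * tv μ₁ μ₂ := by
  have h := (hmix P hP μ₁ μ₂ h₁ h₂).trans
    (mul_le_mul_of_nonneg_right (exp_neg_inv_le hτ) (tv_nonneg μ₁ μ₂))
  calc (τ + 1) * tv (push K P μ₁) (push K P μ₂) ≤ (τ + 1) * (τ / (τ + 1) * tv μ₁ μ₂) := by gcongr
    _ = τ * tv μ₁ μ₂ := by field_simp

/-- Invariant distributions are Lipschitz functions of the policy. -/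
lemma UniformMixing.tv_invariant_le {τ : ℝ} (hmix : UniformMixing K τ) (hτ : 0 < τ)
    (hK : IsTransitionKernel K) (hQ : IsPolicy Q) {π₁ π₂ : X → ℝ}
    (h₁ : IsInvariant K P π₁) (h₂ : IsInvariant K Q π₂) {δ : ℝ} (hδ : ∀ x, tv (P x) (Q x) ≤ δ) :
    tv π₁ π₂ ≤ (τ + 1) * δ := by
  -- Passing through `π₁ K(·|Q)` gives `‖π₁-π₂‖₁ ≤ δ + τ/(τ+1) ‖π₁-π₂‖₁`, which is solved for the
  -- distance.
  have e₁ := tv_push_le_of_policy hK h₁.1 hδ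
  have e₂ := hmix.mul_tv_push_le hτ hQ h₁.1 h₂.1
  have e₃ := tv_triangle (push K P π₁) (push K Q π₁) (push K Q π₂)
  rw [h₁.2, h₂.2] at e₃
  rw [h₁.2] at e₁
  rw [h₂.2] at e₂
  nlinarith

lemma UniformMixing.invariant_unique {τ : ℝ} (hmix : UniformMixing K τ) (hτ : 0 < τ)
    (hK : IsTransitionKernel K) (hP : IsPolicy P) {π₁ π₂ : X → ℝ}
    (h₁ : IsInvariant K P π₁) (h₂ : IsInvariant K P π₂) : π₁ = π₂ := by
  refine eq_of_tv_nonpos ((hmix.tv_invariant_le hτ hK hP h₁ h₂ (δ := 0) fun x => ?_).trans_eq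
    (mul_zero _))
  simp [tv]

/-- The state marginal of a state-action distribution. -/
def marginal (ν : EuclideanSpace ℝ (X × U)) (x : X) : ℝ := ∑ u, ν (x, u)

lemma eq_marginal_mul {ν : EuclideanSpace ℝ (X × U)} (hν : ν ∈ polytope K) (h : Induces ν P)
    (x : X) (u : U) : ν (x, u) = marginal ν x * P x u := by
  by_cases h0 : marginal ν x = 0
  -- A vanishing marginal forces every entry of the row to vanish, so the arbitrary values of `P`
  -- there are harmless.
  · rw [h0, zero_mul]
    exact (Finset.sum_eq_zero_iff_of_nonneg fun v _ => hν.1.1 (x, v)).1 h0 u (Finset.mem_univ u)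
  · rw [h x h0 u]
    exact (mul_div_cancel₀ _ h0).symm

lemma isInvariant_marginal {ν : EuclideanSpace ℝ (X × U)} (hν : ν ∈ polytope K)
    (h : Induces ν P) : IsInvariant K P (marginal ν) := by
  refine ⟨⟨fun x => Finset.sum_nonneg fun u _ => hν.1.1 (x, u), ?_⟩, ?_⟩
  · have := hν.1.2
    rwa [Fintype.sum_prod_type] at this
  · ext y
    rw [marginal, ← hν.2 y, push]
    refine Finset.sum_congr rfl fun x _ => ?_
    rw [stateKernel, Finset.mul_sum]
    refine Finset.sum_congr rfl fun u _ => ?_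
    rw [eq_marginal_mul hν h]
    ring

/-- Every point of the polytope induces a policy. -/
lemma exists_induces {ν : EuclideanSpace ℝ (X × U)} (hν : ν ∈ polytope K) (hQ : IsPolicy Q) :
    ∃ P : X → U → ℝ, IsPolicy P ∧ Induces ν P := by
  classical
  refine ⟨fun x u => if marginal ν x = 0 then Q x u else ν (x, u) / marginal ν x, fun x => ?_,
    fun x hx u => if_neg hx⟩
  by_cases h0 : marginal ν x = 0
  · simpa only [h0, if_true] using hQ x
  · simp only [h0, if_false]
    refine ⟨fun u => div_nonneg (hν.1.1 (x, u))
      (Finset.sum_nonneg fun v _ => hν.1.1 (x, v)), ?_⟩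
    rw [← Finset.sum_div]
    exact div_self h0

lemma inner_toLp (f : X × U → ℝ) (ν : EuclideanSpace ℝ (X × U)) :
    inner ℝ (WithLp.toLp 2 f) ν = ∑ x, ∑ u, ν (x, u) * f (x, u) := by
  rw [PiLp.inner_apply, Fintype.sum_prod_type]
  simp

end Chain

/-! ### From trajectory probabilities to state laws -/

section Trajectories

variable {X U : Type*} [Fintype X] [Fintype U] [DecidableEq X] {K : X → U → X → ℝ}

/-- The distribution of the state `X_{n+1}`. -/
def stateLaw (K : X → U → X → ℝ) (P : ℕ → X → U → ℝ) (x : X) : ℕ → X → ℝ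
  | 0 => fun y => if y = x then 1 else 0
  | n + 1 => push K (P (n + 1)) (stateLaw K P x n)

lemma isDist_stateLaw (hK : IsTransitionKernel K) {P : ℕ → X → U → ℝ} {n : ℕ}
    (hP : ∀ t ∈ Finset.Icc 1 n, IsPolicy (P t)) (x : X) : IsDist (stateLaw K P x n) := by
  induction n with
  | zero =>
    refine ⟨fun y => ?_, by simp [stateLaw]⟩
    simp only [stateLaw]
    split_ifs <;> norm_num
  | succ n ih =>
    exact isDist_push hK (hP (n + 1) (by simp))
      (ih fun t ht => hP t (Finset.Icc_subset_Icc_right (Nat.le_succ n) ht))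

lemma sum_fin_succ_fun {S : Type*} [Fintype S] (n : ℕ) (g : (Fin (n + 1) → S) → ℝ) :
    ∑ ω, g ω = ∑ p : S, ∑ ω : Fin n → S, g (Fin.snoc (α := fun _ => S) ω p) := by
  rw [← (Fin.snocEquiv (fun _ => S)).sum_comp, Fintype.sum_prod_type]
  rfl

lemma pathProb_snoc (P : ℕ → X → U → ℝ) (x : X) (n : ℕ) (ω : Fin (n + 1) → X × U) (p : X × U) :
    pathProb K P x (n + 2) (Fin.snoc (α := fun _ => X × U) ω p) =
      pathProb K P x (n + 1) ω * K (ω (Fin.last n)).1 (ω (Fin.last n)).2 p.1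
        * P (n + 2) p.1 p.2 := by
  rw [pathProb]
  simp only [Fin.snoc_castSucc, Fin.snoc_last]

lemma sum_pathProb_mul_last (P : ℕ → X → U → ℝ) (x : X) (n : ℕ) (g : X × U → ℝ) :
    ∑ ω, pathProb K P x (n + 1) ω * g (ω (Fin.last n)) =
      ∑ y, ∑ u, stateLaw K P x n y * P (n + 1) y u * g (y, u) := by
  induction n generalizing g with
  | zero =>
    rw [sum_fin_succ_fun, Fintype.sum_prod_type]
    refine Finset.sum_congr rfl fun y _ => Finset.sum_congr rfl fun u _ => ?_
    rw [Fintype.sum_unique, Fin.snoc_last]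
    simp [pathProb, stateLaw, Fin.snoc]
  | succ n ih =>
    rw [sum_fin_succ_fun, Fintype.sum_prod_type]
    refine Finset.sum_congr rfl fun y _ => Finset.sum_congr rfl fun u _ => ?_
    simp_rw [pathProb_snoc, Fin.snoc_last]
    -- Testing the law of the last pair against the transition probability to `y` gives the next
    -- state law at `y`.
    have := ih (fun q => K q.1 q.2 y)
    simp only at this
    rw [← Finset.sum_mul, ← Finset.sum_mul, this, stateLaw, push]
    congr 2
    refine Finset.sum_congr rfl fun z _ => ?_
    rw [stateKernel, Finset.mul_sum]
    refine Finset.sum_congr rfl fun v _ => ?_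
    ring

/-- The conditional law of the last pair has total mass one, so the path measures of consecutive
lengths are consistent. -/
lemma sum_pathProb_mul_init (hK : IsTransitionKernel K) {P : ℕ → X → U → ℝ} {n : ℕ}
    (hP : IsPolicy (P (n + 2))) (x : X) (g : (Fin (n + 1) → X × U) → ℝ) :
    ∑ ω, pathProb K P x (n + 2) ω * g (fun i => ω i.castSucc) =
      ∑ ω, pathProb K P x (n + 1) ω * g ω := by
  rw [sum_fin_succ_fun, Finset.sum_comm]
  refine Finset.sum_congr rfl fun ω _ => ?_
  simp_rw [pathProb_snoc, Fin.snoc_castSucc]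
  rw [Fintype.sum_prod_type]
  have : ∀ y u, pathProb K P x (n + 1) ω * K (ω (Fin.last n)).1 (ω (Fin.last n)).2 y
      * P (n + 2) y u * g ω = (pathProb K P x (n + 1) ω * g ω) *
        (K (ω (Fin.last n)).1 (ω (Fin.last n)).2 y * P (n + 2) y u) := fun y u => by ring
  simp_rw [this, ← Finset.mul_sum, (hP _).2, mul_one, (hK _ _).2, mul_one]

lemma expectedCost_eq_sum (hK : IsTransitionKernel K) {P : ℕ → X → U → ℝ} {T : ℕ}
    (hP : ∀ t ∈ Finset.Icc 1 T, IsPolicy (P t)) (f : ℕ → X × U → ℝ) (x : X) :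
    expectedCost K P f x T = ∑ t ∈ Finset.range T,
      ∑ y, ∑ u, stateLaw K P x t y * P (t + 1) y u * f (t + 1) (y, u) := by
  induction T with
  | zero => simp [expectedCost]
  | succ n ih =>
    rw [Finset.sum_range_succ,
      ← ih fun t ht => hP t (Finset.Icc_subset_Icc_right (Nat.le_succ n) ht),
      ← sum_pathProb_mul_last]
    simp only [expectedCost, Fin.sum_univ_castSucc, mul_add, Finset.sum_add_distrib, Fin.val_last,
      Fin.val_castSucc]
    congr 1
    cases n with
    | zero => simp
    | succ n =>
      exact sum_pathProb_mul_init hK (hP (n + 2) (by simp)) x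
        (fun ω => ∑ i : Fin (n + 1), f (i + 1) (ω i))

end Trajectories

/-! ### Telescoping for mirror descent and for the mixing recursion -/

/-- The regret of mirror descent with a self-concordant regularizer. -/
lemma IsRegularizer.mirror_descent_regret {E : Type*} [NormedAddCommGroup E]
    [InnerProductSpace ℝ E] [FiniteDimensional ℝ E] {K : Set E} {F : E → ℝ}
    (hF : IsRegularizer K F) {ρ : ℝ} (hρ : 0 ≤ ρ) {T : ℕ} (hT : 1 ≤ T) {f ν : ℕ → E}
    (h1 : ν 1 ∈ intrinsicInterior ℝ K)
    (hstep : ∀ t, 1 ≤ t → t < T → ν (t + 1) = gradient (dual K F) (grad K F (ν t) - ρ • f t))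
    (hrate : ∀ t ∈ Finset.Icc 1 T, ρ * dualLocalNorm K F (grad K F (ν t)) (f t) ≤ 1 / 2)
    (hnorm : ∀ t ∈ Finset.Icc 1 T, dualLocalNorm K F (grad K F (ν t)) (f t) ≤ 1) :
    (∀ t ∈ Finset.Icc 1 T, ν t ∈ intrinsicInterior ℝ K) ∧
    ∀ z ∈ intrinsicInterior ℝ K,
      ∑ t ∈ Finset.range T, ρ * inner ℝ (f (t + 1)) (ν (t + 1) - z) ≤
        bregman K F z (ν 1) + T * (2 * ρ ^ 2) := by
  have hsq : ∀ t ∈ Finset.Icc 1 T,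
      2 * (ρ * dualLocalNorm K F (grad K F (ν t)) (f t)) ^ 2 ≤ 2 * ρ ^ 2 := fun t ht => by
    rw [mul_pow]
    have h0 : 0 ≤ dualLocalNorm K F (grad K F (ν t)) (f t) := Real.sqrt_nonneg _
    have := mul_le_mul_of_nonneg_left (pow_le_one₀ h0 (hnorm t ht) (n := 2)) (sq_nonneg ρ)
    linarith
  have hmem : ∀ n, n < T → ν (n + 1) ∈ intrinsicInterior ℝ K := by
    intro n
    induction n with
    | zero => exact fun _ => h1
    | succ n ih =>
      intro hn
      exact (hF.mirror_step hρ (ih (by omega)) h1 (hstep (n + 1) (by omega) hn)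
        (hrate _ (Finset.mem_Icc.2 ⟨by omega, by omega⟩))).1
  refine ⟨fun t ht => ?_, fun z hz => ?_⟩
  · rw [Finset.mem_Icc] at ht
    obtain ⟨n, rfl⟩ : ∃ n, t = n + 1 := ⟨t - 1, by omega⟩
    exact hmem n (by omega)
  have hsum : ∀ n, n < T → ∑ t ∈ Finset.range n, ρ * inner ℝ (f (t + 1)) (ν (t + 1) - z) ≤
      bregman K F z (ν 1) - bregman K F z (ν (n + 1)) + n * (2 * ρ ^ 2) := by
    intro n
    induction n with
    | zero => intro _; simp
    | succ n ih =>
      intro hn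
      have ht : n + 1 ∈ Finset.Icc 1 T := Finset.mem_Icc.2 ⟨by omega, by omega⟩
      have := (hF.mirror_step hρ (hmem n (by omega)) hz (hstep (n + 1) (by omega) hn)
        (hrate _ ht)).2
      rw [Finset.sum_range_succ]
      push_cast
      linarith [ih (by omega), hsq _ ht]
  obtain ⟨n, rfl⟩ : ∃ n, T = n + 1 := ⟨T - 1, by omega⟩
  have ht : n + 1 ∈ Finset.Icc 1 (n + 1) := Finset.mem_Icc.2 ⟨by omega, le_rfl⟩
  -- The run stops at `ν T`; a fictitious further step supplies the last inequality, and its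
  -- divergence term is discarded as nonnegative.
  obtain ⟨hw, hlast⟩ := hF.mirror_step hρ (hmem n (by omega)) hz rfl (hrate _ ht)
  have hb := hF.selfConcordantBarrier.bregman_nonneg hF.strictConvex hw hz
  rw [Finset.sum_range_succ]
  push_cast
  linarith [hsum n (by omega), hsq _ ht]

/-- The sum of a sequence with `(τ+1) a_{n+1} ≤ τ a_n + b`. -/
lemma sum_le_of_contraction {τ b : ℝ} (hτ : 0 < τ) (hb : 0 ≤ b) {T : ℕ} {a : ℕ → ℝ}
    (ha : ∀ n, 0 ≤ a n) (h0 : a 0 ≤ 2) (h : ∀ n, n + 1 < T → (τ + 1) * a (n + 1) ≤ τ * a n + b) :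
    ∑ n ∈ Finset.range T, a n ≤ 2 * (τ + 1) + T * b := by
  -- The added potential `τ a_n` absorbs the term `τ a_n` of the recursion, so the induction closes.
  have key : ∀ n, n < T → ∑ i ∈ Finset.range (n + 1), a i + τ * a n ≤ 2 * (τ + 1) + n * b := by
    intro n
    induction n with
    | zero => intro _; simp; nlinarith
    | succ n ih =>
      intro hn
      rw [Finset.sum_range_succ]
      push_cast
      linarith [ih (by omega), h n hn]
  cases T with
  | zero => simp; positivity
  | succ n =>
    have := key n (by omega)
    push_cast
    nlinarith [mul_nonneg hτ.le (ha n)]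

/-! ### Comparison of the actual, steady-state and comparator costs -/

section Regret

variable {X U : Type*} [Fintype X] [Fintype U] {K : X → U → X → ℝ}

lemma tv_le_drift (P : ℕ → X → U → ℝ) {T t : ℕ} (ht : 1 ≤ t) (htT : t + 1 ≤ T) (x : X) :
    tv (P t x) (P (t + 1) x) ≤ drift P T :=
  le_ciSup (f := fun p : Set.Icc 2 T × X => tv (P ((p.1 : ℕ) - 1) p.2) (P (p.1 : ℕ) p.2))
    (Set.finite_range _).bddAbove (⟨t + 1, by omega, htT⟩, x)

lemma drift_nonneg (P : ℕ → X → U → ℝ) (T : ℕ) : 0 ≤ drift P T :=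
  Real.iSup_nonneg fun _ => tv_nonneg _ _

lemma inner_eq_marginal {P : X → U → ℝ} {ν : EuclideanSpace ℝ (X × U)} (hν : ν ∈ polytope K)
    (h : Induces ν P) (f : X × U → ℝ) :
    inner ℝ (WithLp.toLp 2 f) ν = ∑ x, ∑ u, marginal ν x * P x u * f (x, u) := by
  rw [inner_toLp]
  simp_rw [eq_marginal_mul hν h]

/-- The difference of expected costs under two state distributions. -/
lemma sum_cost_sub_le {P : X → U → ℝ} (hP : IsPolicy P) (μ π : X → ℝ) {f : X × U → ℝ} {C : ℝ}
    (hC : ∀ p, |f p| ≤ C) :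
    ∑ x, ∑ u, μ x * P x u * f (x, u) - ∑ x, ∑ u, π x * P x u * f (x, u) ≤ C * tv μ π := by
  rw [← Finset.sum_sub_distrib, tv, Finset.mul_sum]
  refine Finset.sum_le_sum fun x _ => ?_
  rw [← Finset.sum_sub_distrib]
  calc ∑ u, (μ x * P x u * f (x, u) - π x * P x u * f (x, u))
      ≤ ∑ u, P x u * (C * |μ x - π x|) := by
        refine Finset.sum_le_sum fun u _ => ?_
        have e : μ x * P x u * f (x, u) - π x * P x u * f (x, u) =
          P x u * (f (x, u) * (μ x - π x)) := by ring
        rw [e]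
        refine mul_le_mul_of_nonneg_left ((le_abs_self _).trans ?_) ((hP x).1 u)
        rw [abs_mul]
        exact mul_le_mul_of_nonneg_right (hC _) (abs_nonneg _)
    _ = C * |μ x - π x| := by rw [← Finset.sum_mul, (hP x).2, one_mul]

variable [DecidableEq X]

/-- The sum over time of the distances from the state distributions to the invariant ones. -/
lemma sum_tv_stateLaw_le (hK : IsTransitionKernel K) {τ : ℝ} (hτ : 0 < τ)
    (hmix : UniformMixing K τ) {T : ℕ} {P : ℕ → X → U → ℝ} {π : ℕ → X → ℝ}
    (hP : ∀ t ∈ Finset.Icc 1 T, IsPolicy (P t))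
    (hπ : ∀ t ∈ Finset.Icc 1 T, IsInvariant K (P t) (π t)) (x : X) :
    ∑ t ∈ Finset.range T, tv (stateLaw K P x t) (π (t + 1)) ≤
      2 * (τ + 1) + T * ((τ + 1) ^ 2 * drift P T) := by
  rcases Nat.eq_zero_or_pos T with rfl | hT
  · simp; positivity
  have hlaw : ∀ n, n < T → IsDist (stateLaw K P x n) := fun n hn =>
    isDist_stateLaw hK (fun t ht => hP t (Finset.Icc_subset_Icc_right hn.le ht)) x
  refine sum_le_of_contraction hτ (mul_nonneg (sq_nonneg _) (drift_nonneg P T))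
    (fun _ => tv_nonneg _ _)
    (tv_le_two (hlaw 0 hT) (hπ 1 (Finset.mem_Icc.2 ⟨le_rfl, hT⟩)).1) fun n hn => ?_
  have h1 : n + 1 ∈ Finset.Icc 1 T := Finset.mem_Icc.2 ⟨by omega, by omega⟩
  have h2 : n + 2 ∈ Finset.Icc 1 T := Finset.mem_Icc.2 ⟨by omega, by omega⟩
  have hd := hmix.tv_invariant_le hτ hK (hP _ h2) (hπ _ h1) (hπ _ h2)
    (fun y => tv_le_drift P (by omega : 1 ≤ n + 1) (by omega : n + 1 + 1 ≤ T) y)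
  have hc := hmix.mul_tv_push_le hτ (hP _ h1) (hlaw n (by omega)) (hπ _ h1).1
  rw [(hπ _ h1).2] at hc
  have htri := tv_triangle (stateLaw K P x (n + 1)) (π (n + 1)) (π (n + 2))
  -- One factor `τ+1` of `(τ+1)²` normalizes the recursion; the other is the Lipschitz constant of
  -- the invariant distribution.
  have htri' := mul_le_mul_of_nonneg_left htri (by linarith : 0 ≤ τ + 1)
  have hd' := mul_le_mul_of_nonneg_left hd (by linarith : 0 ≤ τ + 1)
  change (τ + 1) * tv (stateLaw K P x (n + 1)) (π (n + 2)) ≤ _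
  change (τ + 1) * tv (stateLaw K P x (n + 1)) (π (n + 1)) ≤ _ at hc
  nlinarith

/-- The expected cost is close to the total steady-state cost of the induced policies. -/
lemma expectedCost_le (hK : IsTransitionKernel K) {τ : ℝ} (hτ : 0 < τ)
    (hmix : UniformMixing K τ) {T : ℕ} {P : ℕ → X → U → ℝ} {ν : ℕ → EuclideanSpace ℝ (X × U)}
    (hP : ∀ t ∈ Finset.Icc 1 T, IsPolicy (P t) ∧ Induces (ν t) (P t))
    (hν : ∀ t ∈ Finset.Icc 1 T, ν t ∈ polytope K) {f : ℕ → X × U → ℝ} {C : ℝ} (hC0 : 0 ≤ C)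
    (hC : ∀ t ∈ Finset.Icc 1 T, ∀ p, |f t p| ≤ C) (x : X) :
    expectedCost K P f x T ≤
      ∑ t ∈ Finset.range T, inner ℝ (WithLp.toLp 2 (f (t + 1))) (ν (t + 1)) +
        C * (2 * (τ + 1) + T * ((τ + 1) ^ 2 * drift P T)) := by
  have hsum := sum_tv_stateLaw_le hK hτ hmix (fun t ht => (hP t ht).1)
    (fun t ht => isInvariant_marginal (hν t ht) (hP t ht).2) x
  rw [expectedCost_eq_sum hK fun t ht => (hP t ht).1]
  refine le_trans ?_ (add_le_add_right (mul_le_mul_of_nonneg_left hsum hC0) _)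
  rw [Finset.mul_sum, ← Finset.sum_add_distrib]
  refine Finset.sum_le_sum fun t ht => ?_
  have ht' : t + 1 ∈ Finset.Icc 1 T :=
    Finset.mem_Icc.2 ⟨by omega, by have := Finset.mem_range.1 ht; omega⟩
  rw [inner_eq_marginal (hν _ ht') (hP _ ht').2]
  linarith [sum_cost_sub_le (hP _ ht').1 (stateLaw K P x t) (marginal (ν (t + 1))) (hC _ ht')]

omit [DecidableEq X] in
/-- A lower bound on the total costs of the points of `G'` is a lower bound on the comparator. -/
lemma le_comparator (hK : IsTransitionKernel K) {τ : ℝ} (hτ : 0 < τ)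
    (hmix : UniformMixing K τ) {G' : Set (EuclideanSpace ℝ (X × U))} (hne : G'.Nonempty)
    (hG' : G' ⊆ polytope K) {Q : X → U → ℝ} (hQ : IsPolicy Q) {f : ℕ → X × U → ℝ} {T : ℕ} {b : ℝ}
    (hb : ∀ z ∈ G', b ≤ ∑ t ∈ Finset.range T, inner ℝ (WithLp.toLp 2 (f (t + 1))) z) :
    b ≤ comparator K (policiesOf G') f T := by
  -- Nonemptiness matters because the real infimum of the empty set is `0`; `Q` fills in the induced
  -- policy at states of zero mass.
  refine le_csInf ?_ ?_
  · obtain ⟨z, hz⟩ := hne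
    obtain ⟨P, hP, hind⟩ := exists_induces (hG' hz) hQ
    exact ⟨_, P, ⟨hP, z, hz, hind⟩, _, isInvariant_marginal (hG' hz) hind, rfl⟩
  · rintro c ⟨P, ⟨hP, z, hz, hind⟩, π, hπ, rfl⟩
    obtain rfl := hmix.invariant_unique hτ hK hP hπ (isInvariant_marginal (hG' hz) hind)
    refine (hb z hz).trans_eq ?_
    have hIcc : ∀ g : ℕ → ℝ, ∑ t ∈ Finset.Icc 1 T, g t = ∑ t ∈ Finset.range T, g (t + 1) := by
      intro g
      rw [Finset.range_eq_Ico, Finset.sum_Ico_add' g 0 T 1]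
      rfl
    simp_rw [inner_eq_marginal (hG' hz) hind, hIcc, Finset.mul_sum]
    rw [Finset.sum_comm]
    refine Finset.sum_congr rfl fun x _ => Finset.sum_comm

end Regret

end OnlineMDP

end

/-! ### The regret bound, first with finite constants, then in the extended reals -/

open OnlineMDP in
/-- The regret bound for finite cost bound and Bregman radius. -/
lemma OnlineMDP.regret_le {X U : Type*} [Fintype X] [Fintype U] [DecidableEq X]
    {K : X → U → X → ℝ} (hK : IsTransitionKernel K)
    {τ : ℝ} (hτ : 0 < τ) (hmix : UniformMixing K τ)
    {F : EuclideanSpace ℝ (X × U) → ℝ} (hF : IsRegularizer (polytope K) F)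
    {G' : Set (EuclideanSpace ℝ (X × U))} (hG'ne : G'.Nonempty)
    (hG' : G' ⊆ intrinsicInterior ℝ (polytope K)) {T : ℕ} (hT : 1 ≤ T)
    {f : ℕ → X × U → ℝ} {C : ℝ} (hC0 : 0 ≤ C) (hC : ∀ t ∈ Finset.Icc 1 T, ∀ p, |f t p| ≤ C)
    {ρ : ℝ} (hρ : 0 < ρ)
    {ν : ℕ → EuclideanSpace ℝ (X × U)} {P : ℕ → X → U → ℝ}
    (hrun : IsMirrorDescentRun K F ρ T f ν P)
    (hrate : ∀ t ∈ Finset.Icc 1 T, ρ * dualLocalNorm (polytope K) F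
        (grad (polytope K) F (ν t)) (WithLp.toLp 2 (f t)) ≤ 1 / 2)
    (hnorm : ∀ t ∈ Finset.Icc 1 T, dualLocalNorm (polytope K) F
        (grad (polytope K) F (ν t)) (WithLp.toLp 2 (f t)) ≤ 1)
    {D : ℝ} (hD : ∀ z ∈ G', bregman (polytope K) F z (ν 1) ≤ D) (x : X) :
    regret K G' P f x T ≤ D / ρ + 2 * ρ * T + C * ((τ + 1) ^ 2 * T * drift P T)
      + (2 * τ + 2) * C := by
  obtain ⟨hmem, hmd⟩ := hF.mirror_descent_regret hρ.le hT (f := fun t => WithLp.toLp 2 (f t))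
    hrun.start_mem hrun.step hrate hnorm
  have hcost := expectedCost_le hK hτ hmix hrun.policy
    (fun t ht => intrinsicInterior_subset (hmem t ht)) hC0 hC x
  have hcomp := le_comparator hK hτ hmix hG'ne (hG'.trans intrinsicInterior_subset)
    (hrun.policy 1 (Finset.mem_Icc.2 ⟨le_rfl, hT⟩)).1 (f := f) (T := T)
    (b := ∑ t ∈ Finset.range T, inner ℝ (WithLp.toLp 2 (f (t + 1))) (ν (t + 1))
      - (D / ρ + 2 * ρ * T)) (by
      intro z hz
      have h1 := hmd z (hG' hz)
      rw [← Finset.mul_sum] at h1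
      simp only [inner_sub_right, Finset.sum_sub_distrib] at h1
      have h2 : D / ρ + 2 * ρ * T = (D + T * (2 * ρ ^ 2)) / ρ := by field_simp
      rw [sub_le_comm, h2, le_div_iff₀' hρ]
      linarith [hD z hz])
  rw [regret]
  linarith

theorem theorem7 {X U : Type*} [Fintype X] [Fintype U] [DecidableEq X]
    (K : X → U → X → ℝ) (hK : OnlineMDP.IsTransitionKernel K)
    (τ : ℝ) (hτ : 0 < τ) (hmix : OnlineMDP.UniformMixing K τ)
    (F : EuclideanSpace ℝ (X × U) → ℝ)
    (hF : OnlineMDP.IsRegularizer (OnlineMDP.polytope K) F)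
    (G' : Set (EuclideanSpace ℝ (X × U))) (hG'ne : G'.Nonempty)
    (hG' : G' ⊆ intrinsicInterior ℝ (OnlineMDP.polytope K))
    (𝓕 : Set (X × U → ℝ)) (T : ℕ) (hT : 1 ≤ T)
    (f : ℕ → X × U → ℝ) (hf : ∀ t ∈ Finset.Icc 1 T, f t ∈ 𝓕)
    (ρ : ℝ) (hρ : 0 < ρ)
    (ν : ℕ → EuclideanSpace ℝ (X × U)) (P : ℕ → X → U → ℝ)
    (hrun : OnlineMDP.IsMirrorDescentRun K F ρ T f ν P)
    (hrate : ∀ t ∈ Finset.Icc 1 T,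
      ρ * OnlineMDP.dualLocalNorm (OnlineMDP.polytope K) F
        (OnlineMDP.grad (OnlineMDP.polytope K) F (ν t)) (WithLp.toLp 2 (f t)) ≤ 1 / 2)
    (hnorm : ∀ t ∈ Finset.Icc 1 T,
      OnlineMDP.dualLocalNorm (OnlineMDP.polytope K) F
        (OnlineMDP.grad (OnlineMDP.polytope K) F (ν t)) (WithLp.toLp 2 (f t)) ≤ 1)
    (x : X) :
    ((OnlineMDP.regret K G' P f x T : ℝ) : EReal) ≤
      OnlineMDP.bregmanSup K F G' (ν 1) / (ρ : EReal)
        + ((2 * ρ * T : ℝ) : EReal)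
        + OnlineMDP.costBound 𝓕 * (((τ + 1) ^ 2 * T * OnlineMDP.drift P T : ℝ) : EReal)
        + ((2 * τ + 2 : ℝ) : EReal) * OnlineMDP.costBound 𝓕 := by

  have h1T : 1 ∈ Finset.Icc 1 T := Finset.mem_Icc.2 ⟨le_rfl, hT⟩
  have hcost : ∀ t ∈ Finset.Icc 1 T, ((‖f t‖ : ℝ) : EReal) ≤ OnlineMDP.costBound 𝓕 :=
    fun t ht => le_iSup₂_of_le (f t) (hf t ht) le_rfl
  have hbreg : ∀ z ∈ G', ((OnlineMDP.bregman (OnlineMDP.polytope K) F z (ν 1) : ℝ) : EReal) ≤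
      OnlineMDP.bregmanSup K F G' (ν 1) := fun z hz => le_iSup₂_of_le z hz le_rfl
  have hC0 : 0 ≤ OnlineMDP.costBound 𝓕 :=
    le_trans (by exact_mod_cast norm_nonneg (f 1)) (hcost 1 h1T)
  obtain ⟨z₀, hz₀⟩ := hG'ne
  have hb0 := hF.selfConcordantBarrier.bregman_nonneg hF.strictConvex hrun.start_mem (hG' hz₀)
  have hD0 : 0 ≤ OnlineMDP.bregmanSup K F G' (ν 1) :=
    le_trans (by exact_mod_cast hb0) (hbreg z₀ hz₀)
  have hdrift : 0 ≤ (τ + 1) ^ 2 * T * OnlineMDP.drift P T :=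
    mul_nonneg (by positivity) (OnlineMDP.drift_nonneg P T)
  have hρE : (0 : EReal) ≤ (ρ : EReal) := by exact_mod_cast hρ.le
  have hA : 0 ≤ OnlineMDP.bregmanSup K F G' (ν 1) / (ρ : EReal) := EReal.div_nonneg hD0 hρE
  have hB : (0 : EReal) ≤ ((2 * ρ * T : ℝ) : EReal) := by
    exact_mod_cast (by positivity : (0 : ℝ) ≤ 2 * ρ * T)
  have hE : 0 ≤ OnlineMDP.costBound 𝓕 *
      (((τ + 1) ^ 2 * T * OnlineMDP.drift P T : ℝ) : EReal) :=
    mul_nonneg hC0 (by exact_mod_cast hdrift)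
  have hG : 0 ≤ ((2 * τ + 2 : ℝ) : EReal) * OnlineMDP.costBound 𝓕 :=
    mul_nonneg (by exact_mod_cast (by positivity : (0 : ℝ) ≤ 2 * τ + 2)) hC0
  -- An infinite constant makes the right-hand side `⊤`: its coefficient in one summand is positive,
  -- and the nonnegative other summands exclude `⊤ + ⊥`.
  by_cases hCtop : OnlineMDP.costBound 𝓕 = ⊤
  · have : ((2 * τ + 2 : ℝ) : EReal) * OnlineMDP.costBound 𝓕 = ⊤ := by
      rw [hCtop]; exact EReal.coe_mul_top_of_pos (by positivity)
    rw [this, EReal.add_top_of_ne_bot (ne_bot_of_le_ne_bot EReal.zero_ne_bot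
      (add_nonneg (add_nonneg hA hB) hE))]
    exact le_top
  by_cases hDtop : OnlineMDP.bregmanSup K F G' (ν 1) = ⊤
  · have : OnlineMDP.bregmanSup K F G' (ν 1) / (ρ : EReal) = ⊤ := by
      rw [hDtop]
      exact EReal.top_div_of_pos_ne_top (by exact_mod_cast hρ) (EReal.coe_ne_top ρ)
    rw [this, add_assoc, add_assoc, EReal.top_add_of_ne_bot (ne_bot_of_le_ne_bot EReal.zero_ne_bot
      (add_nonneg hB (add_nonneg hE hG)))]
    exact le_top
  lift OnlineMDP.costBound 𝓕 to ℝ using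
    ⟨hCtop, ne_bot_of_le_ne_bot EReal.zero_ne_bot hC0⟩ with C
  lift OnlineMDP.bregmanSup K F G' (ν 1) to ℝ using
    ⟨hDtop, ne_bot_of_le_ne_bot EReal.zero_ne_bot hD0⟩ with D
  have := OnlineMDP.regret_le hK hτ hmix hF ⟨z₀, hz₀⟩ hG' hT (f := f) (C := C)
    (by exact_mod_cast hC0)
    (fun t ht p => (norm_le_pi_norm (f t) p).trans (by exact_mod_cast hcost t ht)) hρ hrun hrate
    hnorm (D := D) (fun z hz => by exact_mod_cast hbreg z hz) x
  rw [← EReal.coe_div]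
  exact_mod_cast this
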